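/- **Notation.** For $1\le p<\infty$, $L^p=L^p(\mathbb R)$ is the usual space of real functions with its norm $\|\cdot\|_p$; for $p=\infty$, $L^\infty$ denotes here the space of bounded uniformly continuous functions on $\mathbb R$ with the supremum norm. For an integer $m\ge1$ put $$\omega_m(f,\delta)_p=\sup_{|t|\le\delta}\Big\|\sum_{j=0}^m\binom mj(-1)^{m-j}f(\cdot+jt)\Big\|_p .$$ For $\alpha>0$, $Lip^*(\alpha,L^p)$ is the set of all $f\in L^p$ with $\omega_m(f,\delta)_p=O(\delta^\alpha)$ as $\delta\to0^+$, where $m=\lfloor\alpha\rfloor+1$. A function $\xi:\mathbb R\to\mathbb R$ satisfies $(\Theta)$ with exponent $\theta$ if $\xi(u)=O(|u|^{-\theta})$ as $|u|\to\infty$. Put $$m_\nu(\varphi,u)=\sum_{k\in\mathbb Z}\varphi(u-k)(k-u)^\nu,\qquad \widetilde m_\nu(\psi)=\int_{\mathbb R}u^\nu\psi(u)\,du,\qquad M_0(\xi)=\sup_{u\in\mathbb R}\sum_{k\in\mathbb Z}|\xi(u-k)|,$$ and, for $w>0$, $$(\mathcal D_w^{\varphi,\psi}f)(x)=\sum_{k\in\mathbb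 Z}\varphi(wx-k)\,w\int_{\mathbb R}\psi(wu-k)f(u)\,du,\qquad x\in\mathbb R .$$ **Theorem.** Let $r>1$ be an integer and $0<\alpha<r$. Let $\varphi\in W^{r,1}(\mathbb R)$, that is, $\varphi\in L^1(\mathbb R)$ (continuous representative), $\varphi^{(r-1)}$ exists and is absolutely continuous, and $\varphi^{(r)}\in L^1(\mathbb R)$ (the function $\varphi^{(r)}$ being defined almost everywhere). Let $\psi\in L^1(\mathbb R)$. Suppose that $m_0(\varphi,u)=1$ for every $u\in\mathbb R$, that $\widetilde m_0(\psi)=1$, and that (i) for $\nu=1,\dots,r$ the moment $m_\nu(\varphi,u)=:m_\nu(\varphi)$ does not depend on $u\in\mathbb R$; (ii) $\displaystyle\sum_{\nu=0}^i\binom i\nu m_{i-\nu}(\varphi)\,\widetilde m_\nu(\psi)=0$ for $i=1,\dots,r-1$. Then the following hold. (I) ($p=1$) If $\varphi,\varphi',\dots,\varphi^{(r)}$ satisfy $(\Theta)$ with some exponent $\theta>r+1$, $\psi$ has compact support and $M_0(\psi)<\infty$, then for every $f\in L^1$: $f\in Lip^*(\alpha,L^1)$ if and only if $\|\mathcal D_w^{\varphi,\psi}f-f\|_1=O(w^{-\alpha})$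 as $w\to+\infty$. (II) ($1<p<\infty$) If $\varphi,\varphi',\dots,\varphi^{(r)}$ and $\psi$ satisfy $(\Theta)$ with some exponent $\theta>pr+1$, and $M_0(\varphi^{(r)})<\infty$, $M_0(\psi)<\infty$, then for every $f\in L^p$: $f\in Lip^*(\alpha,L^p)$ if and only if $\|\mathcal D_w^{\varphi,\psi}f-f\|_p=O(w^{-\alpha})$ as $w\to+\infty$. (III) ($p=\infty$) If $\varphi,\varphi',\dots,\varphi^{(r)}$ and $\psi$ satisfy $(\Theta)$ with some exponent $\theta>r+1$, and $M_0(\varphi^{(r)})<\infty$, then for every $f\in L^\infty$: $f\in Lip^*(\alpha,L^\infty)$ if and only if $\|\mathcal D_w^{\varphi,\psi}f-f\|_\infty=O(w^{-\alpha})$ as $w\to+\infty$. -/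

import Mathlib

open MeasureTheory Filter Topology
open scoped ENNReal

noncomputable section

namespace Durrmeyer

/-- The norm of the space `L^p(ℝ)`: for `p < ∞` the usual `L^p` norm, for `p = ∞` the supremum
norm (over all points of `ℝ`). The value lies in `[0, ∞]`. -/
def pNorm (p : ℝ≥0∞) (g : ℝ → ℝ) : ℝ≥0∞ :=
  if p = ⊤ then ⨆ x : ℝ, ‖g x‖ₑ else eLpNorm g p volume

/-- Membership in `L^p(ℝ)`, with the convention that for `p = ∞` this denotes the space `C(ℝ)` of
bounded uniformly continuous functions. -/
def MemSpace (p : ℝ≥0∞) (f : ℝ → ℝ) : Prop :=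
  if p = ⊤ then UniformContinuous f ∧ ∃ B : ℝ, ∀ x, |f x| ≤ B else MemLp f p volume

/-- The Sobolev space `W^{r,p}(ℝ)` for `r ≥ 1`, `1 ≤ p < ∞`: functions `g ∈ L^p(ℝ)` (given by their
continuous representative) with `g^{(r-1)}` absolutely continuous and `g^{(r)} ∈ L^p(ℝ)`. Here
`g^{(r)}` exists almost everywhere (`iteratedDeriv` has the value `0` at the exceptional points).
Since `g^{(r)} ∈ L^p(ℝ)`, absolute continuity on `ℝ` and on every compact interval agree. -/
def MemSobolev (r : ℕ) (p : ℝ≥0∞) (g : ℝ → ℝ) : Prop :=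
  MemLp g p volume ∧
  ContDiff ℝ ((r - 1 : ℕ) : ℕ∞) g ∧
  (∀ a b : ℝ, AbsolutelyContinuousOnInterval (iteratedDeriv (r - 1) g) a b) ∧
  MemLp (iteratedDeriv r g) p volume

/-- The finite difference `Δ^m_t(f, x) = ∑_{j=0}^m (m choose j) (-1)^{m-j} f(x + j t)`. -/
def finDiff (m : ℕ) (t : ℝ) (f : ℝ → ℝ) (x : ℝ) : ℝ :=
  ∑ j ∈ Finset.range (m + 1), (m.choose j : ℝ) * (-1) ^ (m - j) * f (x + j * t)

/-- The modulus of smoothness of order `m`, `ω_m(f, δ)_p = sup_{|t| ≤ δ} ‖Δ^m_t f‖_p`. -/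
def modulus (p : ℝ≥0∞) (m : ℕ) (f : ℝ → ℝ) (δ : ℝ) : ℝ≥0∞ :=
  ⨆ t : ℝ, ⨆ _ : |t| ≤ δ, pNorm p (finDiff m t f)

/-- The generalized Lipschitz class `Lip*(α, L^p)`: functions `f ∈ L^p(ℝ)` such that
`ω_m(f, δ)_p = O(δ^α)` as `δ → 0+`, with `m = ⌊α⌋ + 1`. -/
def MemLipStar (α : ℝ) (p : ℝ≥0∞) (f : ℝ → ℝ) : Prop :=
  MemSpace p f ∧
  ∃ C : ℝ, ∀ᶠ δ in 𝓝[>] (0 : ℝ), modulus p (⌊α⌋₊ + 1) f δ ≤ ENNReal.ofReal (C * δ ^ α)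

/-- The discrete algebraic moment `m_ν(φ, u) = ∑_{k ∈ ℤ} φ(u - k) (k - u)^ν`. -/
def discreteMoment (ν : ℕ) (φ : ℝ → ℝ) (u : ℝ) : ℝ :=
  ∑' k : ℤ, φ (u - k) * (k - u) ^ ν

/-- The continuous algebraic moment `m̃_ν(ψ) = ∫ u^ν ψ(u) du`. -/
def continuousMoment (ν : ℕ) (ψ : ℝ → ℝ) : ℝ :=
  ∫ u : ℝ, u ^ ν * ψ u

/-- The discrete absolute moment `M_ν(ξ) = sup_u ∑_{k ∈ ℤ} |ξ(u - k)| |u - k|^ν`, in `[0, ∞]`. -/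
def absMoment (ν : ℝ) (ξ : ℝ → ℝ) : ℝ≥0∞ :=
  ⨆ u : ℝ, ∑' k : ℤ, ENNReal.ofReal (|ξ (u - k)| * |u - k| ^ ν)

/-- `φ` is a discrete kernel: `m_0(φ, u) = 1` for every `u`. -/
def IsDiscreteKernel (φ : ℝ → ℝ) : Prop :=
  ∀ u : ℝ, discreteMoment 0 φ u = 1

/-- `ψ` is a continuous kernel: `m̃_0(ψ) = 1`. -/
def IsContinuousKernel (ψ : ℝ → ℝ) : Prop :=
  continuousMoment 0 ψ = 1

/-- Condition (i): for `ν = 1, …, r` the moment `m_ν(φ, u)` does not depend on `u`. -/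
def ConstantMoments (r : ℕ) (φ : ℝ → ℝ) : Prop :=
  ∀ ν : ℕ, 1 ≤ ν → ν ≤ r → ∀ u v : ℝ, discreteMoment ν φ u = discreteMoment ν φ v

/-- Condition (ii): `∑_{ν=0}^i (i choose ν) m_{i-ν}(φ) m̃_ν(ψ) = 0` for `i = 1, …, r - 1`. -/
def VanishingMoments (r : ℕ) (φ ψ : ℝ → ℝ) : Prop :=
  ∀ i : ℕ, 1 ≤ i → i < r → ∀ u : ℝ,
    ∑ ν ∈ Finset.range (i + 1),
      (i.choose ν : ℝ) * discreteMoment (i - ν) φ u * continuousMoment ν ψ = 0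

/-- Condition (Θ) with exponent `θ`: `ξ(u) = O(|u|^{-θ})` as `|u| → ∞`. -/
def DecaysLike (θ : ℝ) (ξ : ℝ → ℝ) : Prop :=
  ξ =O[cocompact ℝ] fun u : ℝ => |u| ^ (-θ)

/-- The Durrmeyer sampling operator
`(D_w f)(x) = ∑_{k ∈ ℤ} φ(w x - k) w ∫ ψ(w u - k) f(u) du`. -/
def durrmeyer (φ ψ : ℝ → ℝ) (w : ℝ) (f : ℝ → ℝ) (x : ℝ) : ℝ :=
  ∑' k : ℤ, φ (w * x - k) * (w * ∫ u : ℝ, ψ (w * u - k) * f u)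

/-- `‖D_w f - f‖_p = O(w^{-α})` as `w → +∞`. -/
def HasRate (φ ψ : ℝ → ℝ) (α : ℝ) (p : ℝ≥0∞) (f : ℝ → ℝ) : Prop :=
  ∃ C : ℝ, ∀ᶠ w in atTop,
    pNorm p (fun x => durrmeyer φ ψ w f x - f x) ≤ ENNReal.ofReal (C * w ^ (-α))

end Durrmeyer

end

/-!
The equivalence rests on two inequalities for the Durrmeyer operator `D_w`, valid in the `L^p` norm
for all `1 ≤ p ≤ ∞`, with constants that do not depend on `f` and `w`:

* Jackson: `‖D_w f - f‖ ≤ C ω_r(f, 1 / w)` (`eLpNorm_durrmeyer_sub_le`);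
* Bernstein: `‖Δ^r_t D_w f‖ ≤ C (|t| w)^r ω_r(f, 1 / w)` for `|t| w ≤ 1`
  (`eLpNorm_finDiff_durrmeyer_le`).

By dilation it is enough to have both for `w = 1`, and there they are one statement about operators
`f ↦ ∑_k χ(x - k) ∫ ψ(u - k) f(u) du` that act on polynomials of degree less than `r` as
multiplication by a constant `c`: the distance to `c f` is at most a constant times `ω_r(f, 1)`
(`eLpNorm_sampleOp_sub_le`). For `χ = φ` the moment conditions give `c = 1`
(`reproduces_of_moments`). For `χ = Δ^r_t φ` one has `c = 0`, and the absolute moments of `χ` are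
`O(|t|^r)` because `φ^(r)` has finite ones (`IterPrim.leftBound_finDiff`). Working with differences
of the kernel avoids differentiating the series.

For the general statement, `f` is approximated by a combination `g` of iterated Steklov averages
with `‖f - g‖` and `‖g^(r)‖` bounded by `ω_r(f, 1)` (`exists_iterPrim_approx`). After subtracting
the Taylor polynomial of `g` at `x` two positive integral operators are left, one acting on
`|f - g|` and one on `|g^(r)|`, and Schur's test (`eLpNorm_lintegral_kernel_le`) bounds both.

The direct part of the theorem is the Jackson inequality with `ω_r ≤ 2^(r - m) ω_m`,
`m = ⌊α⌋ + 1 ≤ r`. For the inverse part, the Bernstein inequality yields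
`ω_r(f, s / a) ≤ M s^α + C a^(-r) ω_r(f, s)`; since `α < r`, a large `a` makes this a recursion that
forces `ω_r(f, s) = O(s^α)` (`lpModulus_isBigO_of_recursion`). Marchaud's inequality then lowers the
order from `r` to `m` (`lpModulus_isBigO_of_add`).

All norms are `eLpNorm`. In the case `p = ∞` the functions `f` and `D_w f` are continuous, so that
the supremum and the essential supremum agree.
-/

namespace Durrmeyer

/-! ### Integral inequalities in `L^p` -/

/-- Jensen's inequality for the measure with density `k`. -/
theorem lintegral_mul_rpow_le {S : Type*} [MeasurableSpace S] {μ : Measure S} {k F : S → ℝ≥0∞}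
    (hk : AEMeasurable k μ) (hF : AEMeasurable F μ) {q : ℝ} (hq : 1 ≤ q) :
    (∫⁻ s, k s * F s ∂μ) ^ q ≤ (∫⁻ s, k s ∂μ) ^ (q - 1) * ∫⁻ s, k s * F s ^ q ∂μ := by
  rcases hq.eq_or_lt with rfl | hq1
  · simp
  have hq0 : 0 < q := by linarith
  have hc := Real.HolderConjugate.conjExponent hq1
  set q' := q.conjExponent with hq'
  have h1 : ∀ s, k s * F s = (fun s => k s ^ (1 / q')) s * (fun s => k s ^ (1 / q) * F s) s := by
    intro s
    have : k s ^ (1 / q') * k s ^ (1 / q) = k s := by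
      rw [← ENNReal.rpow_add_of_nonneg _ _ hc.symm.one_div_nonneg hc.one_div_nonneg]
      have h2 : 1 / q' + 1 / q = 1 := by
        have := hc.inv_add_inv_eq_one
        rw [one_div, one_div, add_comm]
        exact this
      rw [h2, ENNReal.rpow_one]
    simp only
    rw [← mul_assoc, this]
  have h2 := ENNReal.lintegral_mul_le_Lp_mul_Lq μ hc.symm (f := fun s => k s ^ (1 / q'))
    (g := fun s => k s ^ (1 / q) * F s) (hk.pow_const _) ((hk.pow_const _).mul hF)
  have hA : ∀ s, (k s ^ (1 / q')) ^ q' = k s := fun s => by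
    rw [← ENNReal.rpow_mul, one_div_mul_cancel hc.symm.ne_zero, ENNReal.rpow_one]
  have hB : ∀ s, (k s ^ (1 / q) * F s) ^ q = k s * F s ^ q := fun s => by
    rw [ENNReal.mul_rpow_of_nonneg _ _ hq0.le, ← ENNReal.rpow_mul,
      one_div_mul_cancel hq0.ne', ENNReal.rpow_one]
  simp only [Pi.mul_apply, hA, hB] at h2
  rw [lintegral_congr h1]
  calc _ ≤ ((∫⁻ s, k s ∂μ) ^ (1 / q') * (∫⁻ s, k s * F s ^ q ∂μ) ^ (1 / q)) ^ q := by gcongr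
    _ = _ := by
      rw [ENNReal.mul_rpow_of_nonneg _ _ hq0.le, ← ENNReal.rpow_mul, ← ENNReal.rpow_mul,
        one_div_mul_cancel hq0.ne', ENNReal.rpow_one]
      congr 2
      rw [hq', Real.conjExponent]
      have : q - 1 ≠ 0 := by linarith
      field_simp

/-- Schur's test. For `p = 1` only the column integrals matter, for `p = ∞` only the row
integrals. -/
theorem eLpNorm_lintegral_kernel_le {K : ℝ → ℝ → ℝ≥0∞} (hK : Measurable (Function.uncurry K))
    {b : ℝ → ℝ≥0∞} (hb : Measurable b) {p : ℝ≥0∞} (hp : 1 ≤ p) {M : ℝ≥0∞}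
    (hrow : p ≠ 1 → ∀ x, ∫⁻ u, K x u ≤ M) (hcol : p ≠ ⊤ → ∀ᵐ u, ∫⁻ x, K x u ≤ M) :
    eLpNorm (fun x => ∫⁻ u, K x u * b u) p volume ≤ M * eLpNorm b p volume := by
  have hKx : ∀ x, Measurable (K x) := fun x => hK.of_uncurry_left
  by_cases hpt : p = ⊤
  · subst hpt
    rw [eLpNorm_exponent_top, eLpNorm_exponent_top]
    refine eLpNormEssSup_le_of_ae_enorm_bound (ae_of_all _ fun x => ?_)
    rw [enorm_eq_self]
    calc ∫⁻ u, K x u * b u ≤ ∫⁻ u, K x u * eLpNormEssSup b volume := by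
          refine lintegral_mono_ae ?_
          filter_upwards [enorm_ae_le_eLpNormEssSup b volume] with u hu
          rw [enorm_eq_self] at hu
          gcongr
      _ = (∫⁻ u, K x u) * eLpNormEssSup b volume := lintegral_mul_const _ (hKx x)
      _ ≤ _ := by gcongr; exact hrow (by simp) x
  have hp0 : p ≠ 0 := by rintro rfl; simp at hp
  set q := p.toReal with hq
  have hq1 : 1 ≤ q := by
    rw [hq, ← ENNReal.toReal_one]; exact ENNReal.toReal_mono hpt hp
  have hq0 : 0 < q := by linarith
  have hKb : Measurable (Function.uncurry fun x u => K x u * b u ^ q) :=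
    hK.mul ((hb.pow_const q).comp measurable_snd)
  have hrow' : ∀ x, (∫⁻ u, K x u) ^ (q - 1) ≤ M ^ (q - 1) := by
    intro x
    by_cases h1 : p = 1
    · have : q - 1 = 0 := by rw [hq, h1]; simp
      simp [this]
    · exact ENNReal.rpow_le_rpow (hrow h1 x) (by linarith)
  have key : ∫⁻ x, (∫⁻ u, K x u * b u) ^ q ≤ M ^ q * ∫⁻ u, b u ^ q := by
    calc ∫⁻ x, (∫⁻ u, K x u * b u) ^ q
        ≤ ∫⁻ x, M ^ (q - 1) * ∫⁻ u, K x u * b u ^ q := by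
          refine lintegral_mono fun x => ?_
          refine (lintegral_mul_rpow_le (hKx x).aemeasurable hb.aemeasurable hq1).trans ?_
          exact mul_le_mul' (hrow' x) le_rfl
      _ = M ^ (q - 1) * ∫⁻ x, ∫⁻ u, K x u * b u ^ q :=
          lintegral_const_mul _ hKb.lintegral_prod_right'
      _ = M ^ (q - 1) * ∫⁻ u, (∫⁻ x, K x u) * b u ^ q := by
          rw [lintegral_lintegral_swap hKb.aemeasurable]
          congr 1
          refine lintegral_congr fun u => ?_
          exact lintegral_mul_const _ hK.of_uncurry_right
      _ ≤ M ^ (q - 1) * ∫⁻ u, M * b u ^ q := by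
          refine mul_le_mul' le_rfl (lintegral_mono_ae ?_)
          filter_upwards [hcol hpt] with u hu
          gcongr
      _ = M ^ q * ∫⁻ u, b u ^ q := by
          rw [lintegral_const_mul _ (hb.pow_const q), ← mul_assoc]
          congr 1
          nth_rewrite 2 [← ENNReal.rpow_one M]
          rw [← ENNReal.rpow_add_of_nonneg _ _ (by linarith) zero_le_one]
          congr 1; ring
  rw [eLpNorm_eq_lintegral_rpow_enorm_toReal hp0 hpt,
    eLpNorm_eq_lintegral_rpow_enorm_toReal hp0 hpt]
  simp only [enorm_eq_self, ← hq]
  calc (∫⁻ x, (∫⁻ u, K x u * b u) ^ q) ^ (1 / q)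
      ≤ (M ^ q * ∫⁻ u, b u ^ q) ^ (1 / q) := ENNReal.rpow_le_rpow key (by positivity)
    _ = _ := by
      rw [ENNReal.mul_rpow_of_nonneg _ _ (by positivity), ← ENNReal.rpow_mul,
        mul_one_div_cancel hq0.ne', ENNReal.rpow_one]

/-- Minkowski's integral inequality, in the form: an average of functions of norm at most `M` has
norm at most `M`. -/
theorem eLpNorm_lintegral_le_of_forall {S : Type*} [MeasurableSpace S] (ν : Measure S)
    [IsProbabilityMeasure ν] {H : ℝ → S → ℝ≥0∞} (hH : Measurable (Function.uncurry H))
    {p : ℝ≥0∞} (hp : 1 ≤ p) {M : ℝ≥0∞}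
    (hM : ∀ᵐ s ∂ν, eLpNorm (fun x => H x s) p volume ≤ M) :
    eLpNorm (fun x => ∫⁻ s, H x s ∂ν) p volume ≤ M := by
  by_cases hpt : p = ⊤
  · subst hpt
    rw [eLpNorm_exponent_top]
    have h1 : ∀ᵐ s ∂ν, ∀ᵐ x, H x s ≤ M := by
      filter_upwards [hM] with s hs
      rw [eLpNorm_exponent_top] at hs
      filter_upwards [enorm_ae_le_eLpNormEssSup (fun x => H x s) volume] with x hx
      exact hx.trans hs
    have h2 : ∀ᵐ x, ∀ᵐ s ∂ν, H x s ≤ M :=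
      (Measure.ae_ae_comm (p := fun x s => H x s ≤ M)
        (measurableSet_le hH measurable_const)).2 h1
    refine eLpNormEssSup_le_of_ae_enorm_bound ?_
    filter_upwards [h2] with x hx
    rw [enorm_eq_self]
    calc ∫⁻ s, H x s ∂ν ≤ ∫⁻ _, M ∂ν := lintegral_mono_ae hx
      _ = M := by simp
  have hp0 : p ≠ 0 := by rintro rfl; simp at hp
  set q := p.toReal with hq
  have hq1 : 1 ≤ q := by
    rw [hq, ← ENNReal.toReal_one]; exact ENNReal.toReal_mono hpt hp
  have hq0 : 0 < q := by linarith
  have key : ∫⁻ x, (∫⁻ s, H x s ∂ν) ^ q ≤ M ^ q := by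
    calc ∫⁻ x, (∫⁻ s, H x s ∂ν) ^ q
          ≤ ∫⁻ x, ∫⁻ s, H x s ^ q ∂ν ∂volume := by
          refine lintegral_mono fun x => ?_
          have := lintegral_mul_rpow_le (μ := ν) (k := fun _ => 1) (F := H x)
            aemeasurable_const hH.of_uncurry_left.aemeasurable hq1
          simpa using this
      _ = ∫⁻ s, ∫⁻ x, H x s ^ q ∂volume ∂ν := lintegral_lintegral_swap (hH.pow_const q).aemeasurable
      _ ≤ ∫⁻ _, M ^ q ∂ν := by
          refine lintegral_mono_ae ?_
          filter_upwards [hM] with s hs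
          rw [eLpNorm_eq_lintegral_rpow_enorm_toReal hp0 hpt] at hs
          simp only [enorm_eq_self, ← hq] at hs
          have := ENNReal.rpow_le_rpow hs hq0.le
          rwa [← ENNReal.rpow_mul, one_div_mul_cancel hq0.ne', ENNReal.rpow_one] at this
      _ = M ^ q := by simp
  rw [eLpNorm_eq_lintegral_rpow_enorm_toReal hp0 hpt]
  simp only [enorm_eq_self, ← hq]
  calc _ ≤ (M ^ q) ^ (1 / q) := ENNReal.rpow_le_rpow key (by positivity)
    _ = M := by rw [← ENNReal.rpow_mul, mul_one_div_cancel hq0.ne', ENNReal.rpow_one]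

/-- Behaviour of the `L^p` norm under dilations; for `p = ∞` the factor is `1`. -/
theorem eLpNorm_comp_const_mul {g : ℝ → ℝ} (hg : AEStronglyMeasurable g volume) {w : ℝ}
    (hw : 0 < w) (p : ℝ≥0∞) :
    eLpNorm (fun x => g (w * x)) p volume
      = ENNReal.ofReal w⁻¹ ^ (1 / p).toReal * eLpNorm g p volume := by
  have hmap := Real.map_volume_mul_left hw.ne'
  rw [abs_of_pos (inv_pos.2 hw)] at hmap
  have hc : ENNReal.ofReal w⁻¹ ≠ 0 := by simpa using hw
  have := eLpNorm_map_measure (f := fun x => w * x) (g := g) (p := p) (μ := volume)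
    (by rw [hmap]; exact hg.smul_measure _) (measurable_const_mul w).aemeasurable
  rw [hmap, eLpNorm_smul_measure_of_ne_zero hc] at this
  exact this.symm

theorem eLpNorm_comp_add_right {g : ℝ → ℝ} (hg : AEStronglyMeasurable g volume) (a : ℝ)
    (p : ℝ≥0∞) : eLpNorm (fun x => g (x + a)) p volume = eLpNorm g p volume :=
  eLpNorm_comp_measurePreserving hg (measurePreserving_add_right volume a)

/-! ### Finite differences and moduli of smoothness -/

theorem finDiff_eq_iterate (m : ℕ) (t : ℝ) (f : ℝ → ℝ) : finDiff m t f = (fwdDiff t)^[m] f := by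
  ext x
  rw [fwdDiff_iter_eq_sum_shift, finDiff]
  refine Finset.sum_congr rfl fun j _ => ?_
  simp only [nsmul_eq_mul, zsmul_eq_mul]
  push_cast
  ring

theorem finDiff_zero (t : ℝ) (f : ℝ → ℝ) : finDiff 0 t f = f := by
  rw [finDiff_eq_iterate]; rfl

theorem finDiff_succ (m : ℕ) (t : ℝ) (f : ℝ → ℝ) :
    finDiff (m + 1) t f = finDiff m t (fun x => f (x + t) - f x) := by
  rw [finDiff_eq_iterate, finDiff_eq_iterate, Function.iterate_succ_apply]; rfl

theorem finDiff_succ' (m : ℕ) (t : ℝ) (f : ℝ → ℝ) :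
    finDiff (m + 1) t f = fun x => finDiff m t f (x + t) - finDiff m t f x := by
  rw [finDiff_eq_iterate, finDiff_eq_iterate, Function.iterate_succ_apply']; rfl

theorem finDiff_comp_const_mul (m : ℕ) (t w : ℝ) (f : ℝ → ℝ) (x : ℝ) :
    finDiff m t (fun y => f (w * y)) x = finDiff m (w * t) f (w * x) := by
  unfold finDiff
  refine Finset.sum_congr rfl fun j _ => ?_
  beta_reduce
  rw [show w * (x + j * t) = w * x + j * (w * t) by ring]

theorem finDiff_sub (m : ℕ) (t : ℝ) (f g : ℝ → ℝ) (x : ℝ) :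
    finDiff m t (fun y => f y - g y) x = finDiff m t f x - finDiff m t g x := by
  simp only [finDiff, mul_sub, Finset.sum_sub_distrib]

theorem finDiff_ae_congr (m : ℕ) (t : ℝ) {f g : ℝ → ℝ} (h : f =ᵐ[volume] g) :
    finDiff m t f =ᵐ[volume] finDiff m t g := by
  have h1 : ∀ j : ℕ, ∀ᵐ x, f (x + j * t) = g (x + j * t) := fun j =>
    (measurePreserving_add_right volume ((j : ℝ) * t)).quasiMeasurePreserving.ae h
  filter_upwards [ae_all_iff.2 h1] with x hx
  simp only [finDiff, hx]

theorem aestronglyMeasurable_comp_add {f : ℝ → ℝ} (hf : AEStronglyMeasurable f volume) (a : ℝ) :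
    AEStronglyMeasurable (fun x => f (x + a)) volume :=
  hf.comp_measurePreserving (measurePreserving_add_right volume a)

theorem aestronglyMeasurable_finDiff (m : ℕ) (t : ℝ) {f : ℝ → ℝ}
    (hf : AEStronglyMeasurable f volume) : AEStronglyMeasurable (finDiff m t f) volume := by
  induction m with
  | zero => rwa [finDiff_zero]
  | succ m ih =>
    rw [finDiff_succ']
    exact (aestronglyMeasurable_comp_add ih t).sub ih

theorem measurable_finDiff (m : ℕ) (t : ℝ) {f : ℝ → ℝ} (hf : Measurable f) :
    Measurable (finDiff m t f) := by
  unfold finDiff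
  fun_prop

theorem eLpNorm_finDiff_succ_le (m : ℕ) (t : ℝ) {f : ℝ → ℝ} {p : ℝ≥0∞} (hp : 1 ≤ p)
    (hf : AEStronglyMeasurable f volume) :
    eLpNorm (finDiff (m + 1) t f) p volume ≤ 2 * eLpNorm (finDiff m t f) p volume := by
  have hm := aestronglyMeasurable_finDiff m t hf
  rw [finDiff_succ', two_mul]
  refine (eLpNorm_sub_le (aestronglyMeasurable_comp_add hm t) hm hp).trans ?_
  rw [eLpNorm_comp_add_right hm]

theorem eLpNorm_finDiff_add_le (m k : ℕ) (t : ℝ) {f : ℝ → ℝ} {p : ℝ≥0∞} (hp : 1 ≤ p)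
    (hf : AEStronglyMeasurable f volume) :
    eLpNorm (finDiff (m + k) t f) p volume ≤ 2 ^ k * eLpNorm (finDiff m t f) p volume := by
  induction k with
  | zero => simp
  | succ k ih =>
    calc _ ≤ 2 * eLpNorm (finDiff (m + k) t f) p volume := eLpNorm_finDiff_succ_le _ t hp hf
      _ ≤ 2 * (2 ^ k * eLpNorm (finDiff m t f) p volume) := by gcongr
      _ = _ := by rw [pow_succ]; ring

theorem finDiff_two_mul (k : ℕ) (t : ℝ) (f : ℝ → ℝ) :
    finDiff k (2 * t) f = (fun (h : ℝ → ℝ) x => h (x + t) + h x)^[k] (finDiff k t f) := by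
  induction k generalizing f with
  | zero => simp [finDiff_zero]
  | succ k ih =>
    rw [finDiff_succ, ih, Function.iterate_succ_apply, finDiff_succ]
    congr 1
    ext x
    simp only [finDiff, ← Finset.sum_add_distrib, ← mul_add]
    refine Finset.sum_congr rfl fun j _ => ?_
    rw [show x + j * t + 2 * t = x + t + j * t + t by ring,
      show x + j * t + t = x + t + j * t by ring]
    ring

theorem eLpNorm_iterate_add_sub_le (k : ℕ) (t : ℝ) {h : ℝ → ℝ} {p : ℝ≥0∞} (hp : 1 ≤ p)
    (hh : AEStronglyMeasurable h volume) :
    AEStronglyMeasurable ((fun (h : ℝ → ℝ) x => h (x + t) + h x)^[k] h) volume ∧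
    eLpNorm (fun x => (fun (h : ℝ → ℝ) x => h (x + t) + h x)^[k] h x - 2 ^ k * h x) p volume
      ≤ ENNReal.ofReal (k * 2 ^ k / 2) * eLpNorm (fun x => h (x + t) - h x) p volume := by
  induction k with
  | zero => simpa using hh
  | succ k ih =>
    obtain ⟨ihm, ih⟩ := ih
    set u := (fun (h : ℝ → ℝ) x => h (x + t) + h x)^[k] h with hu
    rw [Function.iterate_succ_apply', ← hu]
    have hs := aestronglyMeasurable_comp_add ihm t
    refine ⟨hs.add ihm, ?_⟩
    set e : ℝ → ℝ := fun x => u x - 2 ^ k * h x with he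
    set d : ℝ → ℝ := fun x => h (x + t) - h x with hd
    have hem : AEStronglyMeasurable e volume := ihm.sub (hh.const_mul _)
    have hdm : AEStronglyMeasurable d volume := (aestronglyMeasurable_comp_add hh t).sub hh
    have hem' := aestronglyMeasurable_comp_add hem t
    have heq : (fun x => u (x + t) + u x - 2 ^ (k + 1) * h x)
        = ((fun x => e (x + t)) + e) + (2 ^ k : ℝ) • d := by
      ext x
      simp only [he, hd, Pi.add_apply, Pi.smul_apply, smul_eq_mul, pow_succ]
      ring
    calc eLpNorm (fun x => u (x + t) + u x - 2 ^ (k + 1) * h x) p volume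
        ≤ (eLpNorm e p volume + eLpNorm e p volume)
          + ENNReal.ofReal (2 ^ k) * eLpNorm d p volume := by
          rw [heq]
          refine (eLpNorm_add_le (hem'.add hem) (hdm.const_smul _) hp).trans ?_
          refine add_le_add ((eLpNorm_add_le hem' hem hp).trans ?_) ?_
          · rw [eLpNorm_comp_add_right hem]
          · rw [eLpNorm_const_smul, Real.enorm_of_nonneg (by positivity)]
      _ ≤ (ENNReal.ofReal (k * 2 ^ k / 2) * eLpNorm d p volume
            + ENNReal.ofReal (k * 2 ^ k / 2) * eLpNorm d p volume)
          + ENNReal.ofReal (2 ^ k) * eLpNorm d p volume := by gcongr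
      _ = _ := by
        rw [← add_mul, ← add_mul, ← ENNReal.ofReal_add (by positivity) (by positivity),
          ← ENNReal.ofReal_add (by positivity) (by positivity)]
        congr 2
        push_cast
        ring

/-- The inequality behind Marchaud's: with `τ` the translation by `t`, the operator
`(1 + τ)^k - 2^k` is divisible by `τ - 1`. -/
theorem two_pow_mul_eLpNorm_finDiff_le (k : ℕ) (t : ℝ) {f : ℝ → ℝ} {p : ℝ≥0∞} (hp : 1 ≤ p)
    (hf : AEStronglyMeasurable f volume) :
    2 ^ k * eLpNorm (finDiff k t f) p volume ≤ eLpNorm (finDiff k (2 * t) f) p volume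
      + ENNReal.ofReal (k * 2 ^ k / 2) * eLpNorm (finDiff (k + 1) t f) p volume := by
  have hm := aestronglyMeasurable_finDiff k t hf
  obtain ⟨h1, h2⟩ := eLpNorm_iterate_add_sub_le k t hp hm
  rw [← finDiff_two_mul] at h1 h2
  rw [← finDiff_succ'] at h2
  have h3 : (2 : ℝ≥0∞) ^ k * eLpNorm (finDiff k t f) p volume
      = eLpNorm (fun x => 2 ^ k * finDiff k t f x) p volume := by
    have := eLpNorm_const_smul (2 ^ k : ℝ) (finDiff k t f) p volume
    rw [Real.enorm_of_nonneg (by positivity), ENNReal.ofReal_pow (by norm_num)] at this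
    rw [ENNReal.ofReal_ofNat] at this
    exact this.symm
  rw [h3]
  have h4 : (fun x => 2 ^ k * finDiff k t f x) = finDiff k (2 * t) f
      - fun x => finDiff k (2 * t) f x - 2 ^ k * finDiff k t f x := by
    ext x; simp
  rw [h4]
  exact (eLpNorm_sub_le h1 (h1.sub (hm.const_mul _)) hp).trans (add_le_add le_rfl h2)

/-- The modulus of smoothness formed with the `L^p` norm, `1 ≤ p ≤ ∞`; for `p = ∞` this is the
essential supremum norm. -/
noncomputable def lpModulus (p : ℝ≥0∞) (m : ℕ) (f : ℝ → ℝ) (δ : ℝ) : ℝ≥0∞ :=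
  ⨆ t : ℝ, ⨆ _ : |t| ≤ δ, eLpNorm (finDiff m t f) p volume

theorem eLpNorm_finDiff_le_lpModulus (p : ℝ≥0∞) (m : ℕ) (f : ℝ → ℝ) {δ t : ℝ} (ht : |t| ≤ δ) :
    eLpNorm (finDiff m t f) p volume ≤ lpModulus p m f δ :=
  le_iSup₂ (f := fun t (_ : |t| ≤ δ) => eLpNorm (finDiff m t f) p volume) t ht

theorem lpModulus_mono (p : ℝ≥0∞) (m : ℕ) (f : ℝ → ℝ) : Monotone (lpModulus p m f) :=
  fun _ _ h => iSup₂_le fun _ ht => eLpNorm_finDiff_le_lpModulus p m f (ht.trans h)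

theorem lpModulus_add_le (m k : ℕ) {f : ℝ → ℝ} {p : ℝ≥0∞} (hp : 1 ≤ p)
    (hf : AEStronglyMeasurable f volume) (δ : ℝ) :
    lpModulus p (m + k) f δ ≤ 2 ^ k * lpModulus p m f δ :=
  iSup₂_le fun t ht => (eLpNorm_finDiff_add_le m k t hp hf).trans
    (mul_le_mul' le_rfl (eLpNorm_finDiff_le_lpModulus p m f ht))

theorem lpModulus_lt_top (m : ℕ) {f : ℝ → ℝ} {p : ℝ≥0∞} (hp : 1 ≤ p) (hf : MemLp f p volume)
    (δ : ℝ) : lpModulus p m f δ < ⊤ := by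
  refine lt_of_le_of_lt (iSup₂_le fun t _ => ?_)
    (ENNReal.mul_lt_top (ENNReal.pow_lt_top (n := m) (by simp : (2 : ℝ≥0∞) < ⊤)) hf.2)
  have := eLpNorm_finDiff_add_le 0 m t hp hf.1
  rwa [zero_add, finDiff_zero] at this

theorem lpModulus_half_le (k : ℕ) {f : ℝ → ℝ} {p : ℝ≥0∞} (hp : 1 ≤ p)
    (hf : AEStronglyMeasurable f volume) (s : ℝ) :
    2 ^ k * lpModulus p k f (s / 2) ≤ lpModulus p k f s
      + ENNReal.ofReal (k * 2 ^ k / 2) * lpModulus p (k + 1) f (s / 2) := by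
  simp only [lpModulus, ENNReal.mul_iSup]
  refine iSup₂_le fun t ht => (two_pow_mul_eLpNorm_finDiff_le k t hp hf).trans ?_
  refine add_le_add (eLpNorm_finDiff_le_lpModulus p k f ?_) ?_
  · rw [abs_mul, abs_two]; linarith
  · exact le_iSup₂ (f := fun t (_ : |t| ≤ s / 2) => ENNReal.ofReal (k * 2 ^ k / 2) *
      eLpNorm (finDiff (k + 1) t f) p volume) t ht

/-- A Berens–Lorentz type lemma: a monotone function with `ω (s / A) ≤ M s ^ α + q A ^ (-α) ω s`,
`q < 1`, is `O(s ^ α)`. -/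
theorem exists_le_mul_rpow_of_recursion {ω : ℝ → ℝ} (hmono : Monotone ω) {α A M q s₀ : ℝ}
    (hα : 0 < α) (hA : 1 < A) (hq0 : 0 ≤ q) (hq : q < 1) (hs₀ : 0 < s₀)
    (hrec : ∀ s, 0 < s → s ≤ s₀ → ω (s / A) ≤ M * s ^ α + q * A ^ (-α) * ω s) :
    ∃ C, ∀ s, 0 < s → s ≤ s₀ → ω s ≤ C * s ^ α := by
  have hA0 : 0 < A := by linarith
  -- `B` bounds `ω s / s ^ α` on `[s₀ / A, s₀]`, and the recursion reproduces this bound.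
  set B := max 0 (max (ω s₀ * (A / s₀) ^ α) (M * A ^ α / (1 - q))) with hB
  have hB0 : 0 ≤ B := le_max_left _ _
  have hB1 : ω s₀ * (A / s₀) ^ α ≤ B := (le_max_left _ _).trans (le_max_right _ _)
  have hB2 : M * A ^ α + q * B ≤ B := by
    have : M * A ^ α / (1 - q) ≤ B := (le_max_right _ _).trans (le_max_right _ _)
    rw [div_le_iff₀ (by linarith)] at this
    linarith
  have hn : ∀ n : ℕ, ∀ s, s₀ / A ^ (n + 1) ≤ s → s ≤ s₀ → ω s ≤ B * s ^ α := by
    have base : ∀ s, s₀ / A ≤ s → s ≤ s₀ → ω s ≤ B * s ^ α := by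
      intro s h1 h2
      have h3 : 0 < s₀ / A := by positivity
      have h4 : (A / s₀) ^ α * (s₀ / A) ^ α = 1 := by
        rw [← Real.mul_rpow (by positivity) (by positivity)]
        field_simp
        simp
      calc ω s ≤ ω s₀ := hmono h2
        _ = ω s₀ * (A / s₀) ^ α * (s₀ / A) ^ α := by rw [mul_assoc, h4, mul_one]
        _ ≤ B * (s₀ / A) ^ α := by gcongr
        _ ≤ B * s ^ α := by gcongr
    intro n
    induction n with
    | zero => intro s h1 h2; exact base s (by simpa using h1) h2
    | succ n ih =>
      intro s h1 h2
      by_cases h : s₀ / A ≤ s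
      · exact base s h h2
      have hs : 0 < s := lt_of_lt_of_le (by positivity) h1
      have hsA : s * A ≤ s₀ := by
        rw [not_le, lt_div_iff₀ hA0] at h; exact h.le
      have h3 := ih (s * A) (by
        rw [pow_succ, ← div_div, div_le_iff₀ hA0] at h1; exact h1) hsA
      have h4 := hrec (s * A) (by positivity) hsA
      rw [mul_div_cancel_right₀ _ hA0.ne'] at h4
      have h5 : A ^ (-α) * A ^ α = 1 := by
        rw [← Real.rpow_add hA0]; simp
      calc ω s ≤ M * (s * A) ^ α + q * A ^ (-α) * ω (s * A) := h4
        _ ≤ M * (s * A) ^ α + q * A ^ (-α) * (B * (s * A) ^ α) := by gcongr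
        _ = (M * A ^ α + q * B * (A ^ (-α) * A ^ α)) * s ^ α := by
          rw [Real.mul_rpow hs.le hA0.le]; ring
        _ ≤ B * s ^ α := by
          rw [h5, mul_one]; gcongr
  refine ⟨B, fun s hs h => ?_⟩
  obtain ⟨n, hn'⟩ := pow_unbounded_of_one_lt (s₀ / s) hA
  refine hn n s ?_ h
  rw [div_le_iff₀ (by positivity)]
  rw [div_lt_iff₀ hs] at hn'
  have : A ^ n ≤ A ^ (n + 1) := pow_le_pow_right₀ hA.le (by lia)
  nlinarith

/-- The recursion lemma for moduli of smoothness. -/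
theorem lpModulus_isBigO_of_recursion {m : ℕ} {f : ℝ → ℝ} {p : ℝ≥0∞} (hp : 1 ≤ p)
    (hf : MemLp f p volume) {α A M q s₀ : ℝ}
    (hα : 0 < α) (hA : 1 < A) (hM : 0 ≤ M) (hq0 : 0 ≤ q) (hq : q < 1) (hs₀ : 0 < s₀)
    (hrec : ∀ s, 0 < s → s ≤ s₀ → lpModulus p m f (s / A)
      ≤ ENNReal.ofReal (M * s ^ α) + ENNReal.ofReal (q * A ^ (-α)) * lpModulus p m f s) :
    ∃ C, ∀ᶠ δ in 𝓝[>] (0 : ℝ), lpModulus p m f δ ≤ ENNReal.ofReal (C * δ ^ α) := by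
  have hfin : ∀ s, lpModulus p m f s ≠ ⊤ := fun s => (lpModulus_lt_top m hp hf s).ne
  obtain ⟨C, hC⟩ := exists_le_mul_rpow_of_recursion (ω := fun s => (lpModulus p m f s).toReal)
    (fun s t h => ENNReal.toReal_mono (hfin t) (lpModulus_mono p m f h)) hα hA hq0 hq hs₀
    (M := M) (fun s hs h => by
      have h1 := hrec s hs h
      have hA0 : 0 < A := by linarith
      rw [← ENNReal.ofReal_toReal (hfin s), ← ENNReal.ofReal_mul (by positivity),
        ← ENNReal.ofReal_add (by positivity) (by positivity)] at h1
      exact ENNReal.toReal_le_of_le_ofReal (by positivity) h1)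
  refine ⟨C, ?_⟩
  filter_upwards [Ioc_mem_nhdsGT hs₀] with s hs
  rw [← ENNReal.ofReal_toReal (hfin s)]
  exact ENNReal.ofReal_le_ofReal (hC s hs.1 hs.2)

/-- Marchaud's inequality in `O`-form: one order of smoothness can be dropped as long as the order
stays above `α`. -/
theorem lpModulus_isBigO_of_succ {k : ℕ} {f : ℝ → ℝ} {p : ℝ≥0∞} (hp : 1 ≤ p)
    (hf : MemLp f p volume) {α : ℝ} (hα : 0 < α) (hαk : α < k)
    (h : ∃ C, ∀ᶠ δ in 𝓝[>] (0 : ℝ), lpModulus p (k + 1) f δ ≤ ENNReal.ofReal (C * δ ^ α)) :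
    ∃ C, ∀ᶠ δ in 𝓝[>] (0 : ℝ), lpModulus p k f δ ≤ ENNReal.ofReal (C * δ ^ α) := by
  obtain ⟨C, hC⟩ := h
  obtain ⟨s₀, hs₀, hsub⟩ := mem_nhdsGT_iff_exists_Ioc_subset.1 hC
  refine lpModulus_isBigO_of_recursion hp hf hα one_lt_two (M := k / 2 * |C|)
    (q := 2 ^ (α - k)) (by positivity) (by positivity)
    (Real.rpow_lt_one_of_one_lt_of_neg one_lt_two (by linarith)) hs₀ fun s hs hss => ?_
  have h1 := lpModulus_half_le k hp hf.1 s
  have h2 : lpModulus p (k + 1) f (s / 2) ≤ ENNReal.ofReal (|C| * s ^ α) := by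
    refine (hsub (show s / 2 ∈ Set.Ioc 0 s₀ from ⟨by positivity, by linarith⟩)).trans ?_
    refine ENNReal.ofReal_le_ofReal ?_
    calc C * (s / 2) ^ α ≤ |C| * (s / 2) ^ α := by gcongr; exact le_abs_self C
      _ ≤ |C| * s ^ α := by gcongr; linarith
  have h3 : (2 : ℝ≥0∞) ^ k = ENNReal.ofReal (2 ^ k) := by
    rw [ENNReal.ofReal_pow (by norm_num)]; simp
  have h4 : ENNReal.ofReal (2 ^ k)⁻¹ * (2 : ℝ≥0∞) ^ k = 1 := by
    rw [h3, ← ENNReal.ofReal_mul (by positivity), inv_mul_cancel₀ (by positivity)]; simp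
  calc lpModulus p k f (s / 2)
      = ENNReal.ofReal (2 ^ k)⁻¹ * (2 ^ k * lpModulus p k f (s / 2)) := by
        rw [← mul_assoc, h4, one_mul]
    _ ≤ ENNReal.ofReal (2 ^ k)⁻¹ * (lpModulus p k f s
        + ENNReal.ofReal (k * 2 ^ k / 2) * ENNReal.ofReal (|C| * s ^ α)) := by
        gcongr
        exact h1.trans (by gcongr)
    _ = _ := by
      rw [mul_add, add_comm, ← mul_assoc, ← ENNReal.ofReal_mul (by positivity),
        ← ENNReal.ofReal_mul (by positivity)]
      congr 2
      · field_simp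
      · rw [← Real.rpow_add two_pos, ← Real.rpow_natCast, ← Real.rpow_neg two_pos.le]
        congr 2; ring

theorem lpModulus_isBigO_of_add {k : ℕ} (n : ℕ) {f : ℝ → ℝ} {p : ℝ≥0∞} (hp : 1 ≤ p)
    (hf : MemLp f p volume) {α : ℝ} (hα : 0 < α) (hαk : α < k)
    (h : ∃ C, ∀ᶠ δ in 𝓝[>] (0 : ℝ), lpModulus p (k + n) f δ ≤ ENNReal.ofReal (C * δ ^ α)) :
    ∃ C, ∀ᶠ δ in 𝓝[>] (0 : ℝ), lpModulus p k f δ ≤ ENNReal.ofReal (C * δ ^ α) := by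
  induction n with
  | zero => exact h
  | succ n ih =>
    refine ih (lpModulus_isBigO_of_succ hp hf hα ?_ h)
    push_cast
    have : (0 : ℝ) ≤ n := n.cast_nonneg
    linarith

/-! ### Iterated primitives and Taylor's formula -/

/-- `IterPrim n g G`: the function `g` is an `n`-fold primitive of `G`, that is, there is a chain
`g = g₀, g₁, …, gₙ = G` in which each function is an indefinite integral of the next one. This
encodes that `g ^ (n - 1)` is absolutely continuous with almost everywhere derivative `G`, for a
fixed pointwise choice of `G`. -/
def IterPrim : ℕ → (ℝ → ℝ) → (ℝ → ℝ) → Prop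
  | 0, g, G => g = G
  | n + 1, g, G => ∃ g' : ℝ → ℝ, (∀ a b, IntervalIntegrable g' volume a b) ∧
      (∀ x u, g u - g x = ∫ s in x..u, g' s) ∧ IterPrim n g' G

theorem intervalIntegrable_comp_add_right {F : ℝ → ℝ}
    (hF : ∀ a b, IntervalIntegrable F volume a b) (c a b : ℝ) :
    IntervalIntegrable (fun x => F (x + c)) volume a b := by
  have := (hF (a + c) (b + c)).comp_add_right c
  simpa using this

theorem intervalIntegrable_comp_add_mul {F : ℝ → ℝ}
    (hF : ∀ a b, IntervalIntegrable F volume a b) (d c a b : ℝ) :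
    IntervalIntegrable (fun s => F (d + c * s)) volume a b := by
  by_cases hc : c = 0
  · simp [hc]
  have h1 : ∀ a b, IntervalIntegrable (fun x => F (d + x)) volume a b := fun a b => by
    simpa [add_comm] using intervalIntegrable_comp_add_right hF d a b
  have := (h1 (c * a) (c * b)).comp_mul_left (c := c)
  simpa [mul_div_cancel_left₀ _ hc] using this

theorem intervalIntegrable_of_memLp {f : ℝ → ℝ} {p : ℝ≥0∞} (hf : MemLp f p volume) (hp : 1 ≤ p)
    (a b : ℝ) : IntervalIntegrable f volume a b :=
  ((hf.locallyIntegrable hp).integrableOn_isCompact isCompact_uIcc).intervalIntegrable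

theorem IterPrim.add {n : ℕ} {g G h H : ℝ → ℝ} (hg : IterPrim n g G) (hh : IterPrim n h H) :
    IterPrim n (fun x => g x + h x) (fun x => G x + H x) := by
  induction n generalizing g h with
  | zero => simp only [IterPrim] at *; rw [hg, hh]
  | succ n ih =>
    obtain ⟨g', hi, hgi, hgn⟩ := hg
    obtain ⟨h', hi', hhi, hhn⟩ := hh
    refine ⟨_, fun a b => (hi a b).add (hi' a b), fun x u => ?_, ih hgn hhn⟩
    rw [intervalIntegral.integral_add (hi x u) (hi' x u), ← hgi, ← hhi]
    ring

theorem IterPrim.const_mul {n : ℕ} {g G : ℝ → ℝ} (hg : IterPrim n g G) (c : ℝ) :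
    IterPrim n (fun x => c * g x) (fun x => c * G x) := by
  induction n generalizing g with
  | zero => simp only [IterPrim] at *; rw [hg]
  | succ n ih =>
    obtain ⟨g', hi, hgi, hgn⟩ := hg
    refine ⟨_, fun a b => (hi a b).const_mul c, fun x u => ?_, ih hgn⟩
    rw [intervalIntegral.integral_const_mul, ← hgi]
    ring

theorem IterPrim.zero (n : ℕ) : IterPrim n (fun _ => 0) (fun _ => 0) := by
  induction n with
  | zero => rfl
  | succ n ih => exact ⟨_, fun a b => by simp, fun x u => by simp, ih⟩

theorem IterPrim.sum {ι : Type*} (s : Finset ι) {n : ℕ} {g G : ι → ℝ → ℝ}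
    (hg : ∀ i ∈ s, IterPrim n (g i) (G i)) :
    IterPrim n (fun x => ∑ i ∈ s, g i x) (fun x => ∑ i ∈ s, G i x) := by
  classical
  induction s using Finset.induction_on with
  | empty => simpa using IterPrim.zero n
  | insert a s ha ih =>
    simp only [Finset.sum_insert ha]
    exact (hg a (Finset.mem_insert_self _ _)).add
      (ih fun i hi => hg i (Finset.mem_insert_of_mem hi))

theorem IterPrim.comp_add_right {n : ℕ} {g G : ℝ → ℝ} (hg : IterPrim n g G) (c : ℝ) :
    IterPrim n (fun x => g (x + c)) (fun x => G (x + c)) := by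
  induction n generalizing g with
  | zero => simp only [IterPrim] at *; rw [hg]
  | succ n ih =>
    obtain ⟨g', hi, hgi, hgn⟩ := hg
    refine ⟨_, intervalIntegrable_comp_add_right hi c, fun x u => ?_, ih hgn⟩
    rw [hgi, intervalIntegral.integral_comp_add_right]

theorem IterPrim.continuous {n : ℕ} {g G : ℝ → ℝ} (hg : IterPrim (n + 1) g G) :
    Continuous g := by
  obtain ⟨g', hi, hgi, -⟩ := hg
  have : g = fun u => (∫ s in (0 : ℝ)..u, g' s) + g 0 := by
    ext u
    rw [← hgi]; ring
  rw [this]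
  exact (intervalIntegral.continuous_primitive hi 0).add continuous_const

theorem IterPrim.intervalIntegrable {n : ℕ} {g G : ℝ → ℝ} (hg : IterPrim n g G)
    (hG : ∀ a b, IntervalIntegrable G volume a b) (a b : ℝ) : IntervalIntegrable g volume a b := by
  cases n with
  | zero => rw [show g = G from hg]; exact hG a b
  | succ n => exact hg.continuous.intervalIntegrable a b

theorem enorm_intervalIntegral_le (F : ℝ → ℝ) (a b : ℝ) :
    ‖∫ s in a..b, F s‖ₑ ≤ ∫⁻ s in Set.uIoc a b, ‖F s‖ₑ := by
  have h := intervalIntegral.norm_intervalIntegral_eq F a b volume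
  rw [← ofReal_norm, h, ofReal_norm]
  exact enorm_integral_le_lintegral_enorm _

/-- Taylor's formula with an integral bound for the remainder. -/
theorem IterPrim.exists_taylor {n : ℕ} {g G : ℝ → ℝ} (hg : IterPrim (n + 1) g G) (x : ℝ) :
    ∃ a : ℕ → ℝ, a 0 = g x ∧ ∀ u, ‖g u - ∑ i ∈ Finset.range (n + 1), a i * (u - x) ^ i‖ₑ
      ≤ ENNReal.ofReal (|u - x| ^ n) * ∫⁻ s in Set.uIoc x u, ‖G s‖ₑ := by
  induction n generalizing g with
  | zero =>
    obtain ⟨g', hi, hgi, rfl⟩ := hg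
    refine ⟨fun _ => g x, rfl, fun u => ?_⟩
    simpa [hgi x u] using enorm_intervalIntegral_le g' x u
  | succ n ih =>
    obtain ⟨g', hi, hgi, hgn⟩ := hg
    obtain ⟨a, -, ha⟩ := ih hgn
    refine ⟨fun i => if i = 0 then g x else a (i - 1) / i, by simp, fun u => ?_⟩
    have hpow : ∀ i : ℕ, ∫ v in x..u, (v - x) ^ i = (u - x) ^ (i + 1) / (i + 1) := fun i => by
      rw [intervalIntegral.integral_comp_sub_right (fun v => v ^ i), integral_pow]
      simp
    have hpi : ∀ i ∈ Finset.range (n + 1),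
        IntervalIntegrable (fun v => a i * (v - x) ^ i) volume x u := fun i _ =>
      Continuous.intervalIntegrable (by fun_prop) _ _
    have heq : g u - ∑ i ∈ Finset.range (n + 1 + 1),
        (if i = 0 then g x else a (i - 1) / i) * (u - x) ^ i
        = ∫ v in x..u, (g' v - ∑ i ∈ Finset.range (n + 1), a i * (v - x) ^ i) := by
      rw [intervalIntegral.integral_sub (hi x u) (IntervalIntegrable.sum _ hpi |>.congr ?_),
        ← hgi, intervalIntegral.integral_finsetSum hpi, Finset.sum_range_succ']
      · simp only [Nat.add_eq_zero_iff, one_ne_zero, and_false, if_false, if_true, pow_zero,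
          mul_one, Nat.add_sub_cancel, intervalIntegral.integral_const_mul, hpow]
        have : ∀ i : ℕ, a i / ((i + 1 : ℕ) : ℝ) * (u - x) ^ (i + 1)
            = a i * ((u - x) ^ (i + 1) / (i + 1)) := fun i => by push_cast; ring
        simp only [this]
        ring
      · intro v _; simp
    rw [heq]
    calc _ ≤ ∫⁻ v in Set.uIoc x u, ‖g' v - ∑ i ∈ Finset.range (n + 1), a i * (v - x) ^ i‖ₑ :=
          enorm_intervalIntegral_le _ _ _
      _ ≤ ∫⁻ _ in Set.uIoc x u, ENNReal.ofReal (|u - x| ^ n) * ∫⁻ s in Set.uIoc x u, ‖G s‖ₑ := by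
          refine setLIntegral_mono' measurableSet_uIoc fun v hv => (ha v).trans ?_
          have hv' : v ∈ Set.uIcc x u := Set.uIoc_subset_uIcc hv
          refine mul_le_mul' (ENNReal.ofReal_le_ofReal ?_) (lintegral_mono_set ?_)
          · exact pow_le_pow_left₀ (abs_nonneg _) (Set.abs_sub_left_of_mem_uIcc hv') n
          · exact Set.uIoc_subset_uIoc_of_uIcc_subset_uIcc (Set.uIcc_subset_uIcc_left hv')
      _ = _ := by
        rw [setLIntegral_const, Set.uIoc, Real.volume_Ioc, max_sub_min_eq_abs, pow_succ,
          ENNReal.ofReal_mul (by positivity)]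
        ring

/-! ### Steklov averages -/

/-- The Steklov average `∫₀¹ F (x + h s) ds`. For `h = 0` it is `F` itself. -/
noncomputable def steklov (h : ℝ) (F : ℝ → ℝ) (x : ℝ) : ℝ := ∫ s in (0 : ℝ)..1, F (x + h * s)

theorem steklov_zero (F : ℝ → ℝ) : steklov 0 F = F := by
  ext x; simp [steklov]

theorem steklov_zero_iterate (n : ℕ) (F : ℝ → ℝ) : (steklov 0)^[n] F = F := by
  induction n with
  | zero => rfl
  | succ n ih => rw [Function.iterate_succ_apply', ih, steklov_zero]

theorem steklov_sub_steklov {F : ℝ → ℝ} (hF : ∀ a b, IntervalIntegrable F volume a b) {h : ℝ}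
    (hh : h ≠ 0) (x u : ℝ) :
    steklov h F u - steklov h F x = ∫ s in x..u, h⁻¹ * (F (s + h) - F s) := by
  have h1 : ∀ x, steklov h F x = h⁻¹ * ∫ s in x..(x + h), F s := fun x => by
    rw [steklov, intervalIntegral.integral_comp_add_mul _ hh]; simp
  rw [h1, h1, intervalIntegral.integral_const_mul,
    intervalIntegral.integral_sub (intervalIntegrable_comp_add_right hF h x u) (hF x u),
    intervalIntegral.integral_comp_add_right, ← mul_sub,
    intervalIntegral.integral_interval_sub_interval_comm (hF _ _) (hF _ _) (hF _ _),
    intervalIntegral.integral_symm u x, intervalIntegral.integral_symm (u + h)]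
  ring

theorem IterPrim.steklov {n : ℕ} {g G : ℝ → ℝ} (hg : IterPrim n g G)
    (hgi : ∀ a b, IntervalIntegrable g volume a b) {h : ℝ} (hh : h ≠ 0) :
    IterPrim (n + 1) (steklov h g) (fun x => h⁻¹ * (G (x + h) - G x)) := by
  refine ⟨fun s => h⁻¹ * (g (s + h) - g s), fun a b =>
    ((intervalIntegrable_comp_add_right hgi h a b).sub (hgi a b)).const_mul _,
    steklov_sub_steklov hgi hh, ?_⟩
  have := ((hg.comp_add_right h).add (hg.const_mul (-1))).const_mul h⁻¹
  simpa only [neg_mul, one_mul, ← sub_eq_add_neg] using this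

theorem intervalIntegrable_finDiff (m : ℕ) (t : ℝ) {f : ℝ → ℝ}
    (hf : ∀ a b, IntervalIntegrable f volume a b) (a b : ℝ) :
    IntervalIntegrable (finDiff m t f) volume a b := by
  induction m generalizing a b with
  | zero => rw [finDiff_zero]; exact hf a b
  | succ m ih =>
    rw [finDiff_succ']
    exact (intervalIntegrable_comp_add_right ih t a b).sub (ih a b)

theorem iterPrim_steklov_iterate (n : ℕ) {f : ℝ → ℝ} (hf : ∀ a b, IntervalIntegrable f volume a b)
    {h : ℝ} (hh : h ≠ 0) :
    IterPrim n ((steklov h)^[n] f) (fun x => h⁻¹ ^ n * finDiff n h f x) := by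
  induction n with
  | zero => simp [IterPrim, finDiff_zero]
  | succ n ih =>
    rw [Function.iterate_succ_apply']
    have := ih.steklov (ih.intervalIntegrable fun a b =>
      (intervalIntegrable_finDiff n h hf a b).const_mul _) hh
    convert this using 2 with x
    rw [finDiff_succ', pow_succ]
    ring

theorem intervalIntegrable_steklov_iterate (n : ℕ) {f : ℝ → ℝ}
    (hf : ∀ a b, IntervalIntegrable f volume a b) (h a b : ℝ) :
    IntervalIntegrable ((steklov h)^[n] f) volume a b := by
  by_cases hh : h = 0
  · subst hh
    rw [steklov_zero_iterate]; exact hf a b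
  · exact (iterPrim_steklov_iterate n hf hh).intervalIntegrable (fun a b =>
      (intervalIntegrable_finDiff n h hf a b).const_mul _) a b

theorem measurable_steklov (h : ℝ) {F : ℝ → ℝ} (hF : Measurable F) :
    Measurable (steklov h F) := by
  have : StronglyMeasurable (Function.uncurry fun x s : ℝ => F (x + h * s)) :=
    (hF.comp (by fun_prop)).stronglyMeasurable
  have h2 := (this.integral_prod_right (ν := volume.restrict (Set.Ioc 0 1))).measurable
  have h3 : steklov h F = fun x => ∫ s in Set.Ioc (0 : ℝ) 1, F (x + h * s) := by
    ext x; rw [steklov, intervalIntegral.integral_of_le zero_le_one]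
  rwa [h3]

theorem measurable_steklov_iterate (n : ℕ) (h : ℝ) {f : ℝ → ℝ} (hf : Measurable f) :
    Measurable ((steklov h)^[n] f) := by
  induction n with
  | zero => exact hf
  | succ n ih => rw [Function.iterate_succ_apply']; exact measurable_steklov h ih

/-- A linear combination of iterated Steklov averages with step sizes `j h` is an average, over
`t ∈ [0, n h]`, of the same linear combination of the translates `f (· + j t)`. The translation
parameter `y` is needed for the induction. -/
theorem eLpNorm_sum_steklov_iterate_le (J : Finset ℕ) (c : ℕ → ℝ) (h : ℝ) {f : ℝ → ℝ}
    (hf : Measurable f) (hfi : ∀ a b, IntervalIntegrable f volume a b) {p : ℝ≥0∞} (hp : 1 ≤ p)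
    {M : ℝ≥0∞} (n : ℕ) (y : ℝ)
    (hM : ∀ t, |t| ≤ |y| + n * |h| → eLpNorm (fun x => ∑ j ∈ J, c j * f (x + j * t)) p volume ≤ M) :
    eLpNorm (fun x => ∑ j ∈ J, c j * (steklov (j * h))^[n] f (x + j * y)) p volume ≤ M := by
  induction n generalizing y with
  | zero => exact hM y (by simp)
  | succ n ih =>
    set F : ℕ → ℝ → ℝ := fun j => (steklov (j * h))^[n] f with hF
    have hFm : ∀ j, Measurable (F j) := fun j => measurable_steklov_iterate n _ hf
    have hFi : ∀ j a b, IntervalIntegrable (F j) volume a b := fun j =>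
      intervalIntegrable_steklov_iterate n hfi _
    set H : ℝ → ℝ → ℝ := fun x s => ∑ j ∈ J, c j * F j (x + j * (y + h * s)) with hH
    have hHm : Measurable (Function.uncurry H) := by
      simp only [hH, Function.uncurry_def]
      refine Finset.measurable_sum _ fun j _ => ((hFm j).comp ?_).const_mul _
      fun_prop
    have hprob : IsProbabilityMeasure (volume.restrict (Set.Ioc (0 : ℝ) 1)) :=
      ⟨by simp⟩
    have hbound : eLpNorm (fun x => ∫⁻ s in Set.Ioc (0 : ℝ) 1, ‖H x s‖ₑ) p volume ≤ M := by
      refine eLpNorm_lintegral_le_of_forall _ (H := fun x s => ‖H x s‖ₑ) hHm.enorm hp ?_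
      filter_upwards [ae_restrict_mem measurableSet_Ioc] with s hs
      rw [eLpNorm_enorm]
      refine ih (y + h * s) fun t ht => hM t (ht.trans ?_)
      have : |y + h * s| ≤ |y| + |h| := by
        refine (abs_add_le _ _).trans ?_
        rw [abs_mul, abs_of_pos hs.1]
        nlinarith [hs.2, abs_nonneg h]
      push_cast
      linarith
    refine le_trans (eLpNorm_mono_enorm fun x => ?_) hbound
    have heq : ∑ j ∈ J, c j * (steklov (j * h))^[n + 1] f (x + j * y)
        = ∫ s in (0 : ℝ)..1, H x s := by
      rw [hH, intervalIntegral.integral_finsetSum]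
      · refine Finset.sum_congr rfl fun j _ => ?_
        rw [intervalIntegral.integral_const_mul, Function.iterate_succ_apply', steklov]
        congr 2
        ext s
        exact congrArg (F j) (by ring)
      · intro j _
        refine IntervalIntegrable.const_mul ?_ _
        have := intervalIntegrable_comp_add_mul (hFi j) (x + j * y) (j * h) 0 1
        convert this using 3
        ring
    rw [heq, enorm_eq_self]
    have := enorm_intervalIntegral_le (H x) 0 1
    rwa [Set.uIoc_of_le zero_le_one] at this

/-- Smooth approximation: the modulus of smoothness controls both the distance of `f` to a suitable
`g` and the `r`-th derivative `G` of `g`. The function `g` is a combination of Steklov averages. -/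
theorem exists_iterPrim_approx {r : ℕ} (hr : 1 ≤ r) {f : ℝ → ℝ}
    (hf : Measurable f) {p : ℝ≥0∞} (hp : 1 ≤ p) (hfp : MemLp f p volume) :
    ∃ g G : ℝ → ℝ, Measurable g ∧ Measurable G ∧ IterPrim r g G ∧
      eLpNorm (fun x => f x - g x) p volume ≤ lpModulus p r f 1 ∧
      eLpNorm G p volume ≤ ENNReal.ofReal ((2 * r) ^ r) * lpModulus p r f 1 := by
  have hfi := intervalIntegrable_of_memLp hfp hp
  have hr0 : (0 : ℝ) < r := by exact_mod_cast hr
  -- Step sizes `j / r`, `j ≤ r`, keep the translations `j t`, `t ≤ 1`, within reach of the modulus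
  -- at `1`; the term `j = 0` of the resulting sum is `± f`.
  set c : ℕ → ℝ := fun j => (r.choose j : ℝ) * (-1) ^ (r - j) with hc
  set F : ℕ → ℝ → ℝ := fun j => (steklov (j * (r : ℝ)⁻¹))^[r] f with hF
  set d : ℕ → ℝ := fun j => -(-1) ^ r * c (j + 1) with hd
  set k : ℕ → ℝ := fun j => ((j + 1 : ℕ) : ℝ) * (r : ℝ)⁻¹ with hk
  have hk0 : ∀ j, 0 < k j := fun j => by positivity
  have hFm : ∀ j, Measurable (F j) := fun j => measurable_steklov_iterate r _ hf
  have hdm : ∀ j, Measurable (finDiff r (k j) f) := fun j => measurable_finDiff r _ hf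
  refine ⟨fun x => ∑ j ∈ Finset.range r, d j * F (j + 1) x,
    fun x => ∑ j ∈ Finset.range r, d j * ((k j)⁻¹ ^ r * finDiff r (k j) f x),
    by fun_prop, by fun_prop, ?_, ?_, ?_⟩
  · exact IterPrim.sum _ fun j _ => (iterPrim_steklov_iterate r hfi (hk0 j).ne').const_mul _
  · have heq : (fun x => f x - ∑ j ∈ Finset.range r, d j * F (j + 1) x)
        = ((-1 : ℝ) ^ r) • fun x => ∑ j ∈ Finset.range (r + 1),
          c j * (steklov (j * (r : ℝ)⁻¹))^[r] f (x + j * 0) := by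
      ext x
      simp only [Pi.smul_apply, smul_eq_mul, Finset.sum_range_succ', mul_zero, add_zero]
      have h0 : (steklov (((0 : ℕ) : ℝ) * (r : ℝ)⁻¹))^[r] f = f := by
        rw [Nat.cast_zero, zero_mul, steklov_zero_iterate]
      rw [h0, mul_add, ← mul_assoc (_ ^ r) (c 0) (f x)]
      have h1 : (-1 : ℝ) ^ r * c 0 = 1 := by
        simp [hc, ← mul_pow]
      rw [h1, one_mul, Finset.mul_sum]
      simp only [hd, neg_mul, Finset.sum_neg_distrib, mul_assoc]
      rw [sub_neg_eq_add, add_comm]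
    rw [heq, eLpNorm_const_smul]
    have h1 : ‖(-1 : ℝ) ^ r‖ₑ = 1 := by simp [enorm_pow]
    rw [h1, one_mul]
    refine eLpNorm_sum_steklov_iterate_le _ c _ hf hfi hp r 0 fun t ht => ?_
    refine eLpNorm_finDiff_le_lpModulus p r f (ht.trans ?_)
    rw [abs_zero, zero_add, abs_of_pos (inv_pos.2 hr0), mul_inv_cancel₀ hr0.ne']
  · have h1 : ∀ j ∈ Finset.range r,
        eLpNorm (fun x => d j * ((k j)⁻¹ ^ r * finDiff r (k j) f x)) p volume
          ≤ ENNReal.ofReal (r.choose (j + 1) * r ^ r) * lpModulus p r f 1 := by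
      intro j hj
      have hjr : (j : ℝ) + 1 ≤ r := by exact_mod_cast Finset.mem_range.1 hj
      have h2 : (fun x => d j * ((k j)⁻¹ ^ r * finDiff r (k j) f x))
          = (d j * (k j)⁻¹ ^ r) • finDiff r (k j) f := by
        ext x; simp [mul_assoc]
      rw [h2, eLpNorm_const_smul]
      refine mul_le_mul' ?_ (eLpNorm_finDiff_le_lpModulus p r f ?_)
      · rw [← ofReal_norm, Real.norm_eq_abs, abs_mul, abs_pow, abs_of_pos (inv_pos.2 (hk0 j))]
        refine ENNReal.ofReal_le_ofReal ?_
        have h3 : |d j| = r.choose (j + 1) := by simp [hd, hc, abs_mul]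
        rw [h3]
        gcongr
        rw [hk]
        simp only [mul_inv, inv_inv]
        have : ((j + 1 : ℕ) : ℝ)⁻¹ ≤ 1 := by
          refine inv_le_one_of_one_le₀ ?_
          push_cast
          linarith [j.cast_nonneg (α := ℝ)]
        nlinarith
      · rw [abs_of_pos (hk0 j), hk]
        simp only
        rw [← div_eq_mul_inv, div_le_one hr0]
        push_cast
        exact hjr
    have h4 : (fun x => ∑ j ∈ Finset.range r, d j * ((k j)⁻¹ ^ r * finDiff r (k j) f x))
        = ∑ j ∈ Finset.range r, fun x => d j * ((k j)⁻¹ ^ r * finDiff r (k j) f x) := by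
      ext x; simp
    rw [h4]
    refine (eLpNorm_sum_le (fun j _ => Measurable.aestronglyMeasurable (by fun_prop)) hp).trans ?_
    refine (Finset.sum_le_sum h1).trans ?_
    rw [← Finset.sum_mul, ← ENNReal.ofReal_sum_of_nonneg (fun j _ => by positivity)]
    gcongr
    rw [← Finset.sum_mul, mul_pow]
    gcongr
    have := Nat.sum_range_choose r
    rw [Finset.sum_range_succ'] at this
    exact_mod_cast (by omega : ∑ j ∈ Finset.range r, r.choose (j + 1) ≤ 2 ^ r)

section

/-! ### Absolute bounds for sampling kernels -/

/-- The weight `(1 + |x|) ^ r`. -/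
noncomputable def weight (r : ℕ) (x : ℝ) : ℝ≥0∞ := ENNReal.ofReal ((1 + |x|) ^ r)

theorem one_le_weight (r : ℕ) (x : ℝ) : 1 ≤ weight r x := by
  rw [weight, ENNReal.one_le_ofReal]
  exact one_le_pow₀ (by linarith [abs_nonneg x])

theorem weight_ne_top (r : ℕ) (x : ℝ) : weight r x ≠ ⊤ := ENNReal.ofReal_ne_top

theorem measurable_weight (r : ℕ) : Measurable (weight r) := by
  unfold weight
  fun_prop

theorem ofReal_pow_mul_le_weight (n : ℕ) (x u : ℝ) :
    ENNReal.ofReal (|u - x| ^ n) * ENNReal.ofReal (|u - x| + 1)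
      ≤ weight (n + 1) x * weight (n + 1) u := by
  rw [weight, weight, ← ENNReal.ofReal_mul (by positivity), ← ENNReal.ofReal_mul (by positivity)]
  refine ENNReal.ofReal_le_ofReal ?_
  have h1 : |u - x| + 1 ≤ (1 + |x|) * (1 + |u|) := by
    have := abs_sub u x
    nlinarith [abs_nonneg x, abs_nonneg u]
  have h2 : |u - x| ≤ (1 + |x|) * (1 + |u|) := by linarith
  rw [← mul_pow, pow_succ]
  gcongr

/-- Bounds for the kernel `χ` on the side of the output variable, with the weight `(1 + |x|) ^ r`.
The discrete one is not required in the case `p = 1`. -/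
structure LeftBound (r : ℕ) (p : ℝ≥0∞) (χ : ℝ → ℝ) (N : ℝ≥0∞) : Prop where
  lintegral_le : ∫⁻ x, ‖χ x‖ₑ * weight r x ≤ N
  tsum_le : p ≠ 1 → ∀ x : ℝ, ∑' k : ℤ, ‖χ (x - k)‖ₑ * weight r (x - k) ≤ N

/-- Bounds for the kernel `ψ` on the side of the input variable. The discrete one is not required
in the case `p = ∞`; it is an almost everywhere bound, so that it only depends on the class of `ψ`
modulo null sets. -/
structure RightBound (r : ℕ) (p : ℝ≥0∞) (ψ : ℝ → ℝ) (A : ℝ≥0∞) : Prop where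
  lintegral_le : ∫⁻ x, ‖ψ x‖ₑ * weight r x ≤ A
  tsum_le : p ≠ ⊤ → ∀ᵐ u : ℝ, ∑' k : ℤ, ‖ψ (u - k)‖ₑ ≤ A

variable {r : ℕ} {p : ℝ≥0∞} {χ ψ : ℝ → ℝ} {N A : ℝ≥0∞}

theorem LeftBound.lintegral_enorm_le (h : LeftBound r p χ N) : ∫⁻ x, ‖χ x‖ₑ ≤ N :=
  (lintegral_mono fun x => le_mul_of_one_le_right' (one_le_weight r x)).trans h.lintegral_le

theorem LeftBound.tsum_enorm_le (h : LeftBound r p χ N) (hp : p ≠ 1) (x : ℝ) :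
    ∑' k : ℤ, ‖χ (x - k)‖ₑ ≤ N :=
  (ENNReal.tsum_le_tsum fun _ => le_mul_of_one_le_right' (one_le_weight r _)).trans
    (h.tsum_le hp x)

theorem RightBound.lintegral_enorm_le (h : RightBound r p ψ A) : ∫⁻ x, ‖ψ x‖ₑ ≤ A :=
  (lintegral_mono fun x => le_mul_of_one_le_right' (one_le_weight r x)).trans h.lintegral_le

/-- The positive operator that dominates the sampling operator with kernels `χ` and `ψ`. The
argument `F u` may be `∞`. -/
noncomputable def posOp (χ ψ : ℝ → ℝ) (F : ℝ → ℝ≥0∞) (x : ℝ) : ℝ≥0∞ :=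
  ∑' k : ℤ, ‖χ (x - k)‖ₑ * ∫⁻ u, ‖ψ (u - k)‖ₑ * F u

theorem measurable_posOp (hχ : Measurable χ) (ψ : ℝ → ℝ) (F : ℝ → ℝ≥0∞) :
    Measurable (posOp χ ψ F) :=
  Measurable.tsum fun k => ((hχ.comp (measurable_id.sub_const (k : ℝ))).enorm).mul_const _

theorem posOp_mono {F G : ℝ → ℝ≥0∞} (h : ∀ u, F u ≤ G u) (x : ℝ) :
    posOp χ ψ F x ≤ posOp χ ψ G x :=
  ENNReal.tsum_le_tsum fun _ => mul_le_mul' le_rfl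
    (lintegral_mono fun u => mul_le_mul' le_rfl (h u))

theorem posOp_add (hψ : Measurable ψ) {F G : ℝ → ℝ≥0∞} (hF : Measurable F) (x : ℝ) :
    posOp χ ψ (fun u => F u + G u) x = posOp χ ψ F x + posOp χ ψ G x := by
  simp only [posOp]
  rw [← ENNReal.tsum_add]
  refine tsum_congr fun k => ?_
  simp only [mul_add]
  rw [lintegral_add_left, mul_add]
  exact (hψ.comp (measurable_id.sub_const (k : ℝ))).enorm.mul hF

theorem eLpNorm_posOp_le (hp : 1 ≤ p) (hχ : Measurable χ) (hψ : Measurable ψ)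
    (hN : LeftBound r p χ N) (hA : RightBound r p ψ A) {b : ℝ → ℝ≥0∞} (hb : Measurable b) :
    eLpNorm (posOp χ ψ b) p volume ≤ N * A * eLpNorm b p volume := by
  have hψk : ∀ k : ℤ, Measurable fun u : ℝ => ‖ψ (u - k)‖ₑ := fun k =>
    (hψ.comp (measurable_id.sub_const (k : ℝ))).enorm
  have hχk : ∀ k : ℤ, Measurable fun u : ℝ => ‖χ (u - k)‖ₑ := fun k =>
    (hχ.comp (measurable_id.sub_const (k : ℝ))).enorm
  set K : ℝ → ℝ → ℝ≥0∞ := fun x u => ∑' k : ℤ, ‖χ (x - k)‖ₑ * ‖ψ (u - k)‖ₑ with hK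
  have hKm : Measurable (Function.uncurry K) :=
    Measurable.tsum fun k =>
      ((hχk k).comp measurable_fst).mul ((hψk k).comp measurable_snd)
  have heq : posOp χ ψ b = fun x => ∫⁻ u, K x u * b u := by
    ext x
    simp only [posOp, hK, ← ENNReal.tsum_mul_right]
    have hm : ∀ k : ℤ, Measurable fun u => ‖χ (x - k)‖ₑ * ‖ψ (u - k)‖ₑ * b u := fun k =>
      ((hψk k).const_mul _).mul hb
    rw [lintegral_tsum fun k => (hm k).aemeasurable]
    refine tsum_congr fun k => ?_
    rw [← lintegral_const_mul' _ _ enorm_ne_top]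
    simp only [mul_assoc]
  rw [heq]
  refine eLpNorm_lintegral_kernel_le hKm hb hp (fun h1 x => ?_) fun h1 => ?_
  · rw [lintegral_tsum fun k => ((hψk k).const_mul _).aemeasurable]
    calc ∑' k : ℤ, ∫⁻ u, ‖χ (x - k)‖ₑ * ‖ψ (u - k)‖ₑ
        = ∑' k : ℤ, ‖χ (x - k)‖ₑ * ∫⁻ u, ‖ψ u‖ₑ := by
          refine tsum_congr fun k => ?_
          rw [lintegral_const_mul _ (hψk k), lintegral_sub_right_eq_self (fun u => ‖ψ u‖ₑ)]
      _ ≤ _ := by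
          rw [ENNReal.tsum_mul_right]
          exact mul_le_mul' (hN.tsum_enorm_le h1 x) hA.lintegral_enorm_le
  · filter_upwards [hA.tsum_le h1] with u hu
    rw [lintegral_tsum fun k => ((hχk k).mul_const _).aemeasurable]
    calc ∑' k : ℤ, ∫⁻ x, ‖χ (x - k)‖ₑ * ‖ψ (u - k)‖ₑ
        = ∑' k : ℤ, (∫⁻ x, ‖χ x‖ₑ) * ‖ψ (u - k)‖ₑ := by
          refine tsum_congr fun k => ?_
          rw [lintegral_mul_const _ (hχk k), lintegral_sub_right_eq_self (fun u => ‖χ u‖ₑ)]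
      _ ≤ _ := by
          rw [ENNReal.tsum_mul_left]
          exact mul_le_mul' hN.lintegral_enorm_le hu

theorem tsum_indicator_Ioc_le {a b : ℝ} (hab : a ≤ b) (s : ℝ) :
    ∑' k : ℤ, (Set.Ioc a b).indicator (fun _ => (1 : ℝ≥0∞)) (s - k)
      ≤ ENNReal.ofReal (b - a + 1) := by
  have h : ∀ k : ℤ, (Set.Ioc a b).indicator (fun _ => (1 : ℝ≥0∞)) (s - k)
      = if k ∈ Finset.Ico ⌈s - b⌉ ⌈s - a⌉ then 1 else 0 := by
    intro k
    rw [Set.indicator_apply]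
    refine if_congr ?_ rfl rfl
    rw [Finset.mem_Ico, Int.ceil_le, Int.lt_ceil, Set.mem_Ioc]
    constructor
    · rintro ⟨h1, h2⟩; exact ⟨by linarith, by linarith⟩
    · rintro ⟨h1, h2⟩; exact ⟨by linarith, by linarith⟩
  simp only [h]
  rw [tsum_eq_sum (s := Finset.Ico ⌈s - b⌉ ⌈s - a⌉) (fun k hk => by simp [hk])]
  rw [Finset.sum_ite_mem, Finset.inter_self, Finset.sum_const, Int.card_Ico, nsmul_eq_mul, mul_one]
  have h1 : ⌈s - b⌉ ≤ ⌈s - a⌉ := Int.ceil_le_ceil (by linarith)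
  rw [← ENNReal.ofReal_natCast]
  refine ENNReal.ofReal_le_ofReal ?_
  have h2 : (((⌈s - a⌉ - ⌈s - b⌉).toNat : ℤ) : ℝ) = (⌈s - a⌉ : ℝ) - ⌈s - b⌉ := by
    rw [Int.toNat_of_nonneg (by linarith)]; push_cast; ring
  rw [← Int.cast_natCast (R := ℝ), h2]
  linarith [Int.ceil_lt_add_one (s - a), Int.le_ceil (s - b)]

theorem measurable_uIoc_indicator :
    Measurable fun z : (ℝ × ℝ) × ℝ =>
      (Set.uIoc z.1.1 z.2).indicator (fun _ => (1 : ℝ≥0∞)) z.1.2 := by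
  have h : MeasurableSet {z : (ℝ × ℝ) × ℝ | z.1.2 ∈ Set.uIoc z.1.1 z.2} := by
    simp only [Set.uIoc, Set.mem_Ioc, Set.ofPred_and]
    exact (measurableSet_lt (by fun_prop) (by fun_prop)).inter
      (measurableSet_le (by fun_prop) (by fun_prop))
  exact Measurable.indicator (f := fun _ => (1 : ℝ≥0∞)) measurable_const h

/-- The kernel through which the Taylor remainder of order `n + 1` enters the estimates: it is
integrated against the `(n + 1)`-st derivative. -/
noncomputable def remainderKernel (χ ψ : ℝ → ℝ) (n : ℕ) (x s : ℝ) : ℝ≥0∞ :=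
  ∑' k : ℤ, ‖χ (x - k)‖ₑ * ∫⁻ u, ‖ψ (u - k)‖ₑ *
    (ENNReal.ofReal (|u - x| ^ n) * (Set.uIoc x u).indicator (fun _ => 1) s)

theorem measurable_remainderKernel (hχ : Measurable χ) (hψ : Measurable ψ) (n : ℕ) :
    Measurable (Function.uncurry (remainderKernel χ ψ n)) := by
  refine Measurable.tsum fun k => Measurable.mul (hχ.comp (by fun_prop)).enorm ?_
  have h : Measurable fun z : (ℝ × ℝ) × ℝ => ‖ψ (z.2 - k)‖ₑ *
      (ENNReal.ofReal (|z.2 - z.1.1| ^ n) *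
        (Set.uIoc z.1.1 z.2).indicator (fun _ => (1 : ℝ≥0∞)) z.1.2) :=
    (hψ.comp (by fun_prop)).enorm.mul
      (Measurable.mul (by fun_prop) measurable_uIoc_indicator)
  exact h.lintegral_prod_right'

theorem lintegral_remainderKernel_row_le (hψ : Measurable ψ) (n : ℕ)
    (hN : LeftBound (n + 1) p χ N) (hA : RightBound (n + 1) p ψ A) (hp : p ≠ 1) (x : ℝ) :
    ∫⁻ s, remainderKernel χ ψ n x s ≤ N * A := by
  have hm : ∀ k : ℤ, Measurable fun z : ℝ × ℝ => ‖ψ (z.2 - k)‖ₑ *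
      (ENNReal.ofReal (|z.2 - x| ^ n) * (Set.uIoc x z.2).indicator (fun _ => (1 : ℝ≥0∞)) z.1) := by
    intro k
    refine (hψ.comp (by fun_prop)).enorm.mul (Measurable.mul (by fun_prop) ?_)
    exact measurable_uIoc_indicator.comp (g := fun z : (ℝ × ℝ) × ℝ => _)
      (f := fun z : ℝ × ℝ => ((x, z.1), z.2)) (by fun_prop)
  unfold remainderKernel
  rw [lintegral_tsum fun k => ((hm k).lintegral_prod_right'.const_mul _).aemeasurable]
  have hψw : ∀ k : ℤ, ∫⁻ u, ‖ψ (u - k)‖ₑ * weight (n + 1) (u - k) ≤ A := fun k => by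
    rw [lintegral_sub_right_eq_self (fun u => ‖ψ u‖ₑ * weight (n + 1) u)]
    exact hA.lintegral_le
  calc _ ≤ ∑' k : ℤ, ‖χ (x - k)‖ₑ * weight (n + 1) (x - k) * A := by
        refine ENNReal.tsum_le_tsum fun k => ?_
        rw [lintegral_const_mul _ (hm k).lintegral_prod_right',
          lintegral_lintegral_swap (hm k).aemeasurable, mul_assoc]
        refine mul_le_mul' le_rfl ?_
        calc _ ≤ ∫⁻ u, weight (n + 1) (x - k) * (‖ψ (u - k)‖ₑ * weight (n + 1) (u - k)) := by
              refine lintegral_mono fun u => ?_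
              have h1 : ∫⁻ s, (Set.uIoc x u).indicator (fun _ => (1 : ℝ≥0∞)) s
                  ≤ ENNReal.ofReal (|u - x| + 1) := by
                rw [lintegral_indicator_const measurableSet_uIoc, one_mul, Set.uIoc,
                  Real.volume_Ioc, max_sub_min_eq_abs]
                exact ENNReal.ofReal_le_ofReal (by linarith)
              have hind : Measurable ((Set.uIoc x u).indicator (fun _ => (1 : ℝ≥0∞))) :=
                measurable_const.indicator measurableSet_uIoc
              dsimp only
              rw [lintegral_const_mul _ (hind.const_mul _), lintegral_const_mul _ hind]
              have h2 := ofReal_pow_mul_le_weight n (x - k) (u - k)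
              rw [sub_sub_sub_cancel_right] at h2
              calc _ ≤ ‖ψ (u - k)‖ₑ * (weight (n + 1) (x - k) * weight (n + 1) (u - k)) :=
                    mul_le_mul' le_rfl ((mul_le_mul' le_rfl h1).trans h2)
                _ = _ := by ring
          _ ≤ _ := by
              rw [lintegral_const_mul' _ _ (weight_ne_top _ _)]
              exact mul_le_mul' le_rfl (hψw k)
    _ ≤ _ := by
      rw [ENNReal.tsum_mul_right]
      exact mul_le_mul' (hN.tsum_le hp x) le_rfl

/-- For the column integrals, all integer translates are moved to the variable `s`; an interval
contains at most `length + 1` of the points `s - k`. -/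
theorem lintegral_remainderKernel_col_le (hχ : Measurable χ) (hψ : Measurable ψ) (n : ℕ)
    (hN : LeftBound (n + 1) p χ N) (hA : RightBound (n + 1) p ψ A) (s : ℝ) :
    ∫⁻ x, remainderKernel χ ψ n x s ≤ N * A := by
  set Q : ℝ → ℝ → ℝ → ℝ≥0∞ := fun x u s => ‖χ x‖ₑ * (‖ψ u‖ₑ *
    (ENNReal.ofReal (|u - x| ^ n) * (Set.uIoc x u).indicator (fun _ => (1 : ℝ≥0∞)) s)) with hQ
  have hQm : ∀ s, Measurable (Function.uncurry fun x u => Q x u s) := by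
    intro s
    refine (hχ.comp measurable_fst).enorm.mul ((hψ.comp measurable_snd).enorm.mul
      (Measurable.mul (by fun_prop) ?_))
    exact measurable_uIoc_indicator.comp (g := fun z : (ℝ × ℝ) × ℝ => _)
      (f := fun z : ℝ × ℝ => ((z.1, s), z.2)) (by fun_prop)
  have hind : ∀ (x u s k : ℝ), (Set.uIoc x u).indicator (fun _ => (1 : ℝ≥0∞)) s
      = (Set.uIoc (x - k) (u - k)).indicator (fun _ => (1 : ℝ≥0∞)) (s - k) := by
    intro x u s k
    simp only [Set.indicator_apply, Set.uIoc, Set.mem_Ioc, min_sub_sub_right, max_sub_sub_right,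
      sub_lt_sub_iff_right, sub_le_sub_iff_right]
  have hterm : ∀ (k : ℤ) (x : ℝ), ‖χ (x - k)‖ₑ * ∫⁻ u, ‖ψ (u - k)‖ₑ *
      (ENNReal.ofReal (|u - x| ^ n) * (Set.uIoc x u).indicator (fun _ => 1) s)
      = ∫⁻ u, Q (x - k) u (s - k) := by
    intro k x
    rw [← lintegral_sub_right_eq_self (fun u => Q (x - k) u (s - k)) (k : ℝ),
      ← lintegral_const_mul' _ _ enorm_ne_top]
    refine lintegral_congr fun u => ?_
    simp only [hQ]
    rw [← hind, sub_sub_sub_cancel_right]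
  have hcol : ∀ k : ℤ, ∫⁻ x, ∫⁻ u, Q (x - k) u (s - k) = ∫⁻ x, ∫⁻ u, Q x u (s - k) := fun k =>
    lintegral_sub_right_eq_self (fun x => ∫⁻ u, Q x u (s - k)) (k : ℝ)
  unfold remainderKernel
  simp only [hterm]
  have hshift : ∀ k : ℤ, Measurable fun x : ℝ => ∫⁻ u, Q (x - k) u (s - k) := fun k =>
    Measurable.comp (g := fun x => ∫⁻ u, Q x u (s - k)) (hQm _).lintegral_prod_right'
      (measurable_id.sub_const (k : ℝ))
  rw [lintegral_tsum fun k => (hshift k).aemeasurable]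
  simp only [hcol]
  have hQk : ∀ k : ℤ, Measurable fun x => ∫⁻ u, Q x u (s - k) := fun k =>
    (hQm _).lintegral_prod_right'
  rw [← lintegral_tsum fun k => (hQk k).aemeasurable]
  calc ∫⁻ x, ∑' k : ℤ, ∫⁻ u, Q x u (s - k)
      = ∫⁻ x, ∫⁻ u, ∑' k : ℤ, Q x u (s - k) := by
        refine lintegral_congr fun x => ?_
        rw [lintegral_tsum fun k => (hQm _).of_uncurry_left.aemeasurable]
    _ ≤ ∫⁻ x, ∫⁻ u, (‖χ x‖ₑ * weight (n + 1) x) * (‖ψ u‖ₑ * weight (n + 1) u) := by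
        refine lintegral_mono fun x => lintegral_mono fun u => ?_
        simp only [hQ]
        rw [ENNReal.tsum_mul_left, ENNReal.tsum_mul_left, ENNReal.tsum_mul_left]
        have h1 : ∑' k : ℤ, (Set.uIoc x u).indicator (fun _ => (1 : ℝ≥0∞)) (s - k)
            ≤ ENNReal.ofReal (|u - x| + 1) := by
          rw [← max_sub_min_eq_abs]
          exact tsum_indicator_Ioc_le min_le_max s
        calc _ ≤ ‖χ x‖ₑ * (‖ψ u‖ₑ * (weight (n + 1) x * weight (n + 1) u)) :=
              mul_le_mul' le_rfl (mul_le_mul' le_rfl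
                ((mul_le_mul' le_rfl h1).trans (ofReal_pow_mul_le_weight n x u)))
          _ = _ := by ring
    _ = (∫⁻ x, ‖χ x‖ₑ * weight (n + 1) x) * ∫⁻ u, ‖ψ u‖ₑ * weight (n + 1) u := by
        have h1 : Measurable fun u => ‖ψ u‖ₑ * weight (n + 1) u :=
          hψ.enorm.mul (measurable_weight _)
        have h2 : Measurable fun x => ‖χ x‖ₑ * weight (n + 1) x :=
          hχ.enorm.mul (measurable_weight _)
        simp only [lintegral_const_mul _ h1]
        rw [lintegral_mul_const _ h2]
    _ ≤ N * A := mul_le_mul' hN.lintegral_le hA.lintegral_le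

theorem posOp_remainder_eq (hψ : Measurable ψ) (n : ℕ) {b : ℝ → ℝ≥0∞}
    (hb : Measurable b) (x : ℝ) :
    posOp χ ψ (fun u => ENNReal.ofReal (|u - x| ^ n) * ∫⁻ s in Set.uIoc x u, b s) x
      = ∫⁻ s, remainderKernel χ ψ n x s * b s := by
  have hm : ∀ k : ℤ, Measurable fun z : ℝ × ℝ => ‖ψ (z.2 - k)‖ₑ *
      (ENNReal.ofReal (|z.2 - x| ^ n) * (Set.uIoc x z.2).indicator (fun _ => (1 : ℝ≥0∞)) z.1) := by
    intro k
    refine (hψ.comp (by fun_prop)).enorm.mul (Measurable.mul (by fun_prop) ?_)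
    exact measurable_uIoc_indicator.comp (g := fun z : (ℝ × ℝ) × ℝ => _)
      (f := fun z : ℝ × ℝ => ((x, z.1), z.2)) (by fun_prop)
  unfold posOp remainderKernel
  simp only [← ENNReal.tsum_mul_right]
  have hm' : ∀ k : ℤ, Measurable fun s : ℝ => (‖χ (x - k)‖ₑ * ∫⁻ u, ‖ψ (u - k)‖ₑ *
      (ENNReal.ofReal (|u - x| ^ n) * (Set.uIoc x u).indicator (fun _ => 1) s)) * b s := fun k =>
    ((hm k).lintegral_prod_right'.const_mul _).mul hb
  rw [lintegral_tsum fun k => (hm' k).aemeasurable]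
  refine tsum_congr fun k => ?_
  simp only [mul_assoc]
  rw [lintegral_const_mul' _ _ enorm_ne_top]
  congr 1
  have hmu : ∀ s, Measurable fun u : ℝ => ‖ψ (u - k)‖ₑ *
      (ENNReal.ofReal (|u - x| ^ n) * (Set.uIoc x u).indicator (fun _ => (1 : ℝ≥0∞)) s) :=
    fun s => (hm k).comp (measurable_prodMk_left (x := s))
  have h1 : ∀ s, (∫⁻ u, ‖ψ (u - k)‖ₑ * (ENNReal.ofReal (|u - x| ^ n) *
      (Set.uIoc x u).indicator (fun _ => (1 : ℝ≥0∞)) s)) * b s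
      = ∫⁻ u, ‖ψ (u - k)‖ₑ * (ENNReal.ofReal (|u - x| ^ n) *
      (Set.uIoc x u).indicator (fun _ => (1 : ℝ≥0∞)) s) * b s := fun s =>
    (lintegral_mul_const _ (hmu s)).symm
  simp only [h1]
  have h2 : Measurable (Function.uncurry fun s u : ℝ => ‖ψ (u - k)‖ₑ *
      (ENNReal.ofReal (|u - x| ^ n) *
      (Set.uIoc x u).indicator (fun _ => (1 : ℝ≥0∞)) s) * b s) :=
    (hm k).mul (hb.comp measurable_fst)
  rw [lintegral_lintegral_swap h2.aemeasurable]
  refine lintegral_congr fun u => ?_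
  simp only [mul_assoc]
  have h3 : Measurable fun s => (Set.uIoc x u).indicator (fun _ => (1 : ℝ≥0∞)) s * b s :=
    (measurable_const.indicator measurableSet_uIoc).mul hb
  rw [lintegral_const_mul _ (h3.const_mul _), lintegral_const_mul _ h3,
    ← lintegral_indicator measurableSet_uIoc]
  refine congrArg _ (congrArg _ (lintegral_congr fun s => ?_))
  by_cases hs : s ∈ Set.uIoc x u <;> simp [hs]

theorem measurable_posOp_remainder (hχ : Measurable χ) (hψ : Measurable ψ) (n : ℕ)
    {b : ℝ → ℝ≥0∞} (hb : Measurable b) :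
    Measurable fun x =>
      posOp χ ψ (fun u => ENNReal.ofReal (|u - x| ^ n) * ∫⁻ s in Set.uIoc x u, b s) x := by
  rw [funext fun x => posOp_remainder_eq hψ n hb x]
  exact ((measurable_remainderKernel hχ hψ n).mul (hb.comp measurable_snd)).lintegral_prod_right'

theorem eLpNorm_posOp_remainder_le (hp : 1 ≤ p) (hχ : Measurable χ) (hψ : Measurable ψ) (n : ℕ)
    (hN : LeftBound (n + 1) p χ N) (hA : RightBound (n + 1) p ψ A)
    {b : ℝ → ℝ≥0∞} (hb : Measurable b) :
    eLpNorm (fun x =>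
      posOp χ ψ (fun u => ENNReal.ofReal (|u - x| ^ n) * ∫⁻ s in Set.uIoc x u, b s) x) p volume
      ≤ N * A * eLpNorm b p volume := by
  rw [funext fun x => posOp_remainder_eq hψ n hb x]
  exact eLpNorm_lintegral_kernel_le (measurable_remainderKernel hχ hψ n) hb hp
    (fun h x => lintegral_remainderKernel_row_le hψ n hN hA h x)
    fun _ => ae_of_all _ fun s => lintegral_remainderKernel_col_le hχ hψ n hN hA s

end

section

variable {r : ℕ} {p : ℝ≥0∞} {χ ψ : ℝ → ℝ} {N A : ℝ≥0∞}

/-! ### Sampling operators that reproduce polynomials -/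

/-- The sampling operator with step size `1` and arbitrary kernels; `durrmeyer φ ψ w` is its
conjugate by a dilation. -/
noncomputable def sampleOp (χ ψ : ℝ → ℝ) (f : ℝ → ℝ) (x : ℝ) : ℝ :=
  ∑' k : ℤ, χ (x - k) * ∫ u, ψ (u - k) * f u

theorem enorm_sampleOp_term_le (χ ψ f : ℝ → ℝ) (x : ℝ) (k : ℤ) :
    ‖χ (x - k) * ∫ u, ψ (u - k) * f u‖ₑ ≤ ‖χ (x - k)‖ₑ * ∫⁻ u, ‖ψ (u - k)‖ₑ * ‖f u‖ₑ := by
  rw [enorm_mul]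
  refine mul_le_mul' le_rfl ((enorm_integral_le_lintegral_enorm _).trans_eq ?_)
  simp only [enorm_mul]

theorem enorm_sampleOp_le (χ ψ f : ℝ → ℝ) (x : ℝ) :
    ‖sampleOp χ ψ f x‖ₑ ≤ posOp χ ψ (fun u => ‖f u‖ₑ) x :=
  enorm_tsum_le_tsum_enorm.trans (ENNReal.tsum_le_tsum (enorm_sampleOp_term_le χ ψ f x))

theorem summable_of_tsum_enorm_ne_top {ι : Type*} {a : ι → ℝ} (h : ∑' i, ‖a i‖ₑ ≠ ⊤) :
    Summable a := by
  refine Summable.of_nnnorm ?_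
  rw [← ENNReal.tsum_coe_ne_top_iff_summable]
  exact h

theorem summable_sampleOp {f : ℝ → ℝ} {x : ℝ} (h : posOp χ ψ (fun u => ‖f u‖ₑ) x ≠ ⊤) :
    Summable fun k : ℤ => χ (x - k) * ∫ u, ψ (u - k) * f u :=
  summable_of_tsum_enorm_ne_top
    (ne_top_of_le_ne_top h (ENNReal.tsum_le_tsum (enorm_sampleOp_term_le χ ψ f x)))

theorem sampleOp_add (hψ : Measurable ψ) {f g : ℝ → ℝ} (hf : Measurable f) (hg : Measurable g)
    {x : ℝ} (hfx : posOp χ ψ (fun u => ‖f u‖ₑ) x ≠ ⊤) (hgx : posOp χ ψ (fun u => ‖g u‖ₑ) x ≠ ⊤) :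
    sampleOp χ ψ (fun u => f u + g u) x = sampleOp χ ψ f x + sampleOp χ ψ g x := by
  have hψk : ∀ k : ℤ, Measurable fun u : ℝ => ψ (u - k) := fun k =>
    hψ.comp (measurable_id.sub_const (k : ℝ))
  -- Where `χ (x - k) ≠ 0`, finiteness of the dominating sum makes the `k`-th integrand integrable.
  have hint : ∀ {f : ℝ → ℝ}, Measurable f → posOp χ ψ (fun u => ‖f u‖ₑ) x ≠ ⊤ → ∀ k : ℤ,
      χ (x - k) ≠ 0 → Integrable (fun u => ψ (u - k) * f u) := by
    intro f hf hfx k hk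
    refine ⟨((hψk k).mul hf).aestronglyMeasurable, ?_⟩
    rw [hasFiniteIntegral_iff_enorm]
    simp only [enorm_mul]
    have h1 := ENNReal.ne_top_of_tsum_ne_top hfx k
    rw [lt_top_iff_ne_top]
    intro h2
    rw [h2, ENNReal.mul_top (by simpa using hk)] at h1
    exact h1 rfl
  rw [sampleOp, sampleOp, sampleOp, ← (summable_sampleOp hfx).tsum_add (summable_sampleOp hgx)]
  refine tsum_congr fun k => ?_
  by_cases hk : χ (x - k) = 0
  · simp [hk]
  · rw [← mul_add, ← integral_add (hint hf hfx k hk) (hint hg hgx k hk)]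
    simp only [mul_add]

/-- The sampling operator with kernels `χ` and `ψ` acts on polynomials of degree less than `r` as
multiplication by `c`, the defining series and integrals being absolutely convergent. -/
def Reproduces (r : ℕ) (χ ψ : ℝ → ℝ) (c : ℝ) : Prop :=
  ∀ P : Polynomial ℝ, P.natDegree < r → ∀ x,
    posOp χ ψ (fun u => ‖P.eval u‖ₑ) x ≠ ⊤ ∧ sampleOp χ ψ (fun u => P.eval u) x = c * P.eval x

theorem enorm_sampleOp_sub_le (hψ : Measurable ψ) {f : ℝ → ℝ} (hf : Measurable f) {c x : ℝ}
    {P : Polynomial ℝ} (hP : posOp χ ψ (fun u => ‖P.eval u‖ₑ) x ≠ ⊤)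
    (hPc : sampleOp χ ψ (fun u => P.eval u) x = c * P.eval x) :
    ‖sampleOp χ ψ f x - c * f x‖ₑ
      ≤ posOp χ ψ (fun u => ‖f u - P.eval u‖ₑ) x + ‖c‖ₑ * ‖f x - P.eval x‖ₑ := by
  by_cases h : posOp χ ψ (fun u => ‖f u - P.eval u‖ₑ) x = ⊤
  · simp [h]
  have h1 := sampleOp_add (g := fun u => P.eval u) hψ (hf.sub P.continuous.measurable)
    P.continuous.measurable h hP
  simp only [Pi.sub_apply, sub_add_cancel] at h1
  have h2 : sampleOp χ ψ f x - c * f x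
      = sampleOp χ ψ (fun u => f u - P.eval u) x - c * (f x - P.eval x) := by
    rw [show sampleOp χ ψ f x = _ from h1, hPc]
    simp only [Pi.sub_def]
    ring
  rw [h2]
  refine (enorm_sub_le).trans (add_le_add (enorm_sampleOp_le _ _ _ _) ?_)
  rw [enorm_mul]

/-- If the sampling operator acts as multiplication by `c` on polynomials of degree less than `r`,
then it acts approximately so on any `f`, with an error controlled by the modulus of smoothness of
order `r`. -/
theorem eLpNorm_sampleOp_sub_le (hr : 1 ≤ r) (hp : 1 ≤ p) (hχ : Measurable χ) (hψ : Measurable ψ)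
    (hN : LeftBound r p χ N) (hA : RightBound r p ψ A) {c : ℝ} (hc : Reproduces r χ ψ c)
    {f : ℝ → ℝ} (hf : Measurable f) (hfp : MemLp f p volume) :
    eLpNorm (fun x => sampleOp χ ψ f x - c * f x) p volume
      ≤ (N * A * (1 + ENNReal.ofReal ((2 * r) ^ r)) + ‖c‖ₑ) * lpModulus p r f 1 := by
  obtain ⟨g, G, hg, hG, hgG, hfg, hGω⟩ := exists_iterPrim_approx hr hf hp hfp
  obtain ⟨n, rfl⟩ : ∃ n, r = n + 1 := ⟨r - 1, by omega⟩
  set ω := lpModulus p (n + 1) f 1 with hω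
  set C := ENNReal.ofReal ((2 * ((n + 1 : ℕ) : ℝ)) ^ (n + 1)) with hC
  have hd : Measurable fun u => ‖f u - g u‖ₑ := (hf.sub hg).enorm
  set T1 : ℝ → ℝ≥0∞ := posOp χ ψ (fun u => ‖f u - g u‖ₑ) with hT1
  set T2 : ℝ → ℝ≥0∞ := fun x => posOp χ ψ (fun u => ENNReal.ofReal (|u - x| ^ n) *
    ∫⁻ s in Set.uIoc x u, ‖G s‖ₑ) x with hT2
  set T3 : ℝ → ℝ≥0∞ := fun x => ‖c * (f x - g x)‖ₑ with hT3
  have hm1 : Measurable T1 := measurable_posOp hχ ψ _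
  have hm2 : Measurable T2 := measurable_posOp_remainder hχ hψ n hG.enorm
  have hm3 : Measurable T3 := ((hf.sub hg).const_mul c).enorm
  have hpt : ∀ x, ‖sampleOp χ ψ f x - c * f x‖ₑ ≤ (T1 + T2 + T3) x := by
    intro x
    obtain ⟨a, ha0, ha⟩ := hgG.exists_taylor x
    set P : Polynomial ℝ := ∑ i ∈ Finset.range (n + 1),
      Polynomial.C (a i) * (Polynomial.X - Polynomial.C x) ^ i with hP
    have hPe : ∀ u, P.eval u = ∑ i ∈ Finset.range (n + 1), a i * (u - x) ^ i := fun u => by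
      simp [hP, Polynomial.eval_finsetSum]
    have hPx : P.eval x = g x := by
      rw [hPe, Finset.sum_range_succ']
      simp [ha0]
    have hPd : P.natDegree < n + 1 := by
      refine Nat.lt_succ_of_le (Polynomial.natDegree_sum_le_of_forall_le _ _ fun i hi => ?_)
      refine (Polynomial.natDegree_C_mul_le _ _).trans
        (Polynomial.natDegree_pow_le_of_le i (Polynomial.natDegree_X_sub_C_le x) |>.trans ?_)
      have := Finset.mem_range.1 hi
      omega
    obtain ⟨h1, h2⟩ := hc P hPd x
    refine (enorm_sampleOp_sub_le hψ hf h1 h2).trans ?_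
    simp only [Pi.add_apply]
    refine add_le_add ?_ ?_
    · rw [hT1, hT2]
      simp only
      rw [← posOp_add hψ hd]
      refine posOp_mono (fun u => ?_) x
      have h3 : f u - P.eval u = (f u - g u) + (g u - P.eval u) := by ring
      rw [h3]
      refine (enorm_add_le _ _).trans (add_le_add le_rfl ?_)
      rw [hPe]
      exact ha u
    · rw [hT3, hPx, ← enorm_mul]
  have hT1b : eLpNorm T1 p volume ≤ N * A * ω := by
    refine (eLpNorm_posOp_le hp hχ hψ hN hA hd).trans ?_
    rw [eLpNorm_enorm]
    exact mul_le_mul' le_rfl hfg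
  have hT2b : eLpNorm T2 p volume ≤ N * A * (C * ω) := by
    refine (eLpNorm_posOp_remainder_le hp hχ hψ n hN hA hG.enorm).trans ?_
    rw [eLpNorm_enorm]
    exact mul_le_mul' le_rfl hGω
  have hT3b : eLpNorm T3 p volume ≤ ‖c‖ₑ * ω := by
    rw [hT3, eLpNorm_enorm]
    have := eLpNorm_const_smul c (fun x => f x - g x) p volume
    simp only [Pi.smul_def, smul_eq_mul] at this
    rw [this]
    exact mul_le_mul' le_rfl hfg
  calc _ ≤ eLpNorm (T1 + T2 + T3) p volume := eLpNorm_mono_enorm fun x => by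
        rw [enorm_eq_self]; exact hpt x
    _ ≤ eLpNorm T1 p volume + eLpNorm T2 p volume + eLpNorm T3 p volume := by
        refine (eLpNorm_add_le (hm1.add hm2).aestronglyMeasurable hm3.aestronglyMeasurable hp).trans
          (add_le_add ?_ le_rfl)
        exact eLpNorm_add_le hm1.aestronglyMeasurable hm2.aestronglyMeasurable hp
    _ ≤ N * A * ω + N * A * (C * ω) + ‖c‖ₑ * ω := by gcongr
    _ = _ := by ring

theorem finDiff_eval_eq_zero {P : Polynomial ℝ} (hP : P.natDegree < r) (t x : ℝ) :
    finDiff r t (fun u => P.eval u) x = 0 := by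
  set Q := P.comp (Polynomial.C x + Polynomial.C t * Polynomial.X) with hQ
  have hQd : Q.natDegree < r := by
    refine lt_of_le_of_lt ?_ hP
    rw [hQ]
    refine Polynomial.natDegree_comp_le.trans ?_
    have : (Polynomial.C x + Polynomial.C t * Polynomial.X).natDegree ≤ 1 := by
      refine (Polynomial.natDegree_add_le _ _).trans ?_
      simp only [Polynomial.natDegree_C, zero_le, sup_of_le_right]
      exact (Polynomial.natDegree_C_mul_le _ _).trans Polynomial.natDegree_X_le
    nlinarith
  have h1 := congrFun (Polynomial.fwdDiff_iter_eq_zero_of_degree_lt hQd) 0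
  rw [← finDiff_eq_iterate] at h1
  rw [← show finDiff r 1 (fun u => Q.eval u) 0 = 0 from h1]
  simp only [finDiff, hQ, Polynomial.eval_comp, Polynomial.eval_add, Polynomial.eval_mul,
    Polynomial.eval_C, Polynomial.eval_X]
  refine Finset.sum_congr rfl fun j _ => ?_
  congr 2
  ring

theorem posOp_finDiff_ne_top (m : ℕ) (t : ℝ) {F : ℝ → ℝ≥0∞} {x : ℝ}
    (h : ∀ j ∈ Finset.range (m + 1), posOp χ ψ F (x + j * t) ≠ ⊤) :
    posOp (finDiff m t χ) ψ F x ≠ ⊤ := by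
  have h1 : posOp (finDiff m t χ) ψ F x
      ≤ ∑ j ∈ Finset.range (m + 1), ‖(m.choose j : ℝ) * (-1) ^ (m - j)‖ₑ *
        posOp χ ψ F (x + j * t) := by
    simp only [posOp, ← ENNReal.tsum_mul_left]
    rw [← Summable.tsum_finsetSum fun _ _ => ENNReal.summable]
    refine ENNReal.tsum_le_tsum fun k => ?_
    simp only [← mul_assoc, ← Finset.sum_mul]
    refine mul_le_mul' ?_ le_rfl
    refine (enorm_sum_le _ _).trans (Finset.sum_le_sum fun j _ => ?_)
    rw [enorm_mul, sub_add_eq_add_sub]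
  refine ne_top_of_le_ne_top (ENNReal.sum_ne_top.2 fun j hj => ?_) h1
  exact ENNReal.mul_ne_top enorm_ne_top (h j hj)

/-- Taking differences of the sampling operator amounts to taking differences of its kernel. -/
theorem sampleOp_finDiff (m : ℕ) (t : ℝ) {f : ℝ → ℝ} {x : ℝ}
    (h : ∀ j ∈ Finset.range (m + 1), posOp χ ψ (fun u => ‖f u‖ₑ) (x + j * t) ≠ ⊤) :
    sampleOp (finDiff m t χ) ψ f x = finDiff m t (sampleOp χ ψ f) x := by
  simp only [sampleOp, finDiff, Finset.sum_mul]
  rw [Summable.tsum_finsetSum]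
  · refine Finset.sum_congr rfl fun j _ => ?_
    rw [← tsum_mul_left]
    refine tsum_congr fun k => ?_
    rw [sub_add_eq_add_sub, mul_assoc]
  · intro j hj
    have := (summable_sampleOp (h j hj)).mul_left ((m.choose j : ℝ) * (-1) ^ (m - j))
    refine this.congr fun k => ?_
    rw [sub_add_eq_add_sub]
    exact (mul_assoc _ _ _).symm

theorem Reproduces.finDiff {c : ℝ} (h : Reproduces r χ ψ c) (t : ℝ) :
    Reproduces r (finDiff r t χ) ψ 0 := by
  intro P hP x
  refine ⟨posOp_finDiff_ne_top r t fun j _ => (h P hP _).1, ?_⟩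
  rw [sampleOp_finDiff r t fun j _ => (h P hP _).1,
    show sampleOp χ ψ (fun u => P.eval u) = fun x => c * P.eval x from funext fun x => (h P hP x).2]
  have h1 := finDiff_eval_eq_zero hP t x
  have h2 : Durrmeyer.finDiff r t (fun x => c * P.eval x) x
      = c * Durrmeyer.finDiff r t (fun x => P.eval x) x := by
    simp only [Durrmeyer.finDiff, Finset.mul_sum]
    exact Finset.sum_congr rfl fun j _ => by ring
  rw [h2, h1]
  ring

theorem enorm_pow_le_weight {i : ℕ} (hi : i ≤ r) (u : ℝ) : ‖u ^ i‖ₑ ≤ weight r u := by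
  rw [weight, ← ofReal_norm, norm_pow, Real.norm_eq_abs]
  refine ENNReal.ofReal_le_ofReal ?_
  calc |u| ^ i ≤ (1 + |u|) ^ i := by gcongr; linarith
    _ ≤ (1 + |u|) ^ r := pow_le_pow_right₀ (by linarith [abs_nonneg u]) hi

/-- The moment conditions on the kernels mean that the sampling operator reproduces polynomials of
degree less than `r`. -/
theorem reproduces_of_moments {φ : ℝ → ℝ} (hr : 1 ≤ r) (hψ : Measurable ψ)
    (hφN : ∀ x, ∑' k : ℤ, ‖φ (x - k)‖ₑ * weight r (x - k) ≠ ⊤)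
    (hψA : ∫⁻ u, ‖ψ u‖ₑ * weight r u ≠ ⊤)
    (hφ0 : IsDiscreteKernel φ) (hψ0 : IsContinuousKernel ψ) (hii : VanishingMoments r φ ψ) :
    Reproduces r φ ψ 1 := by
  have hψi : ∀ i ≤ r, Integrable fun u => u ^ i * ψ u := by
    intro i hi
    refine ⟨Measurable.aestronglyMeasurable (by fun_prop), ?_⟩
    rw [hasFiniteIntegral_iff_enorm, lt_top_iff_ne_top]
    refine ne_top_of_le_ne_top hψA (lintegral_mono fun u => ?_)
    rw [enorm_mul, mul_comm]
    exact mul_le_mul' le_rfl (enorm_pow_le_weight hi u)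
  have hφs : ∀ i ≤ r, ∀ x : ℝ, Summable fun k : ℤ => φ (x - k) * (k - x) ^ i := by
    intro i hi x
    refine summable_of_tsum_enorm_ne_top
      (ne_top_of_le_ne_top (hφN x) (ENNReal.tsum_le_tsum fun k => ?_))
    rw [enorm_mul]
    refine mul_le_mul' le_rfl ?_
    have := enorm_pow_le_weight hi ((k : ℝ) - x)
    rwa [weight, abs_sub_comm, ← weight] at this
  intro P hP x
  set a : ℕ → ℝ := fun i => (Polynomial.taylor x P).coeff i with ha
  have hPe : ∀ u, P.eval u = ∑ i ∈ Finset.range r, a i * (u - x) ^ i := fun u => by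
    have h1 := Polynomial.taylor_eval x P (u - x)
    rw [sub_add_cancel] at h1
    rw [← h1, Polynomial.eval_eq_sum_range' (by rwa [Polynomial.natDegree_taylor])]
  constructor
  · have h1 : ∀ (k : ℤ) (u : ℝ), ‖P.eval u‖ₑ
        ≤ (∑ i ∈ Finset.range r, ‖a i‖ₑ) * (weight r (x - k) * weight r (u - k)) := by
      intro k u
      rw [hPe, Finset.sum_mul]
      refine (enorm_sum_le _ _).trans (Finset.sum_le_sum fun i hi => ?_)
      rw [enorm_mul]
      refine mul_le_mul' le_rfl ?_
      have hi' : i ≤ r := (Finset.mem_range.1 hi).le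
      rw [weight, weight, ← ENNReal.ofReal_mul (by positivity), ← ofReal_norm, norm_pow,
        Real.norm_eq_abs, ← mul_pow]
      refine ENNReal.ofReal_le_ofReal ?_
      have h2 : |u - x| ≤ |u - k| + |x - k| := by
        have := abs_sub (u - k) (x - k)
        rwa [sub_sub_sub_cancel_right] at this
      have h3 : |u - x| ≤ (1 + |x - k|) * (1 + |u - k|) := by
        nlinarith [abs_nonneg (u - k), abs_nonneg (x - k)]
      have h4 : 1 ≤ (1 + |x - k|) * (1 + |u - k|) := by
        nlinarith [abs_nonneg (u - k), abs_nonneg (x - k),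
          mul_nonneg (abs_nonneg (u - k)) (abs_nonneg (x - k))]
      calc |u - x| ^ i ≤ ((1 + |x - k|) * (1 + |u - k|)) ^ i := by gcongr
        _ ≤ _ := pow_le_pow_right₀ h4 hi'
    set S := ∑ i ∈ Finset.range r, ‖a i‖ₑ with hS
    have hSt : S ≠ ⊤ := ENNReal.sum_ne_top.2 fun _ _ => enorm_ne_top
    have h2 : posOp φ ψ (fun u => ‖P.eval u‖ₑ) x
        ≤ ∑' k : ℤ, (‖φ (x - k)‖ₑ * weight r (x - k)) *
          (S * ∫⁻ u, ‖ψ u‖ₑ * weight r u) := by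
      refine ENNReal.tsum_le_tsum fun k => ?_
      calc _ ≤ ‖φ (x - k)‖ₑ * ∫⁻ u, (S * weight r (x - k)) *
            (‖ψ (u - k)‖ₑ * weight r (u - k)) := by
            refine mul_le_mul' le_rfl (lintegral_mono fun u => ?_)
            calc _ ≤ ‖ψ (u - k)‖ₑ * (S * (weight r (x - k) * weight r (u - k))) :=
                  mul_le_mul' le_rfl (h1 k u)
              _ = _ := by ring
        _ = _ := by
            rw [lintegral_const_mul' _ _ (ENNReal.mul_ne_top hSt (weight_ne_top _ _)),
              lintegral_sub_right_eq_self (fun u => ‖ψ u‖ₑ * weight r u)]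
            ring
    refine ne_top_of_le_ne_top ?_ h2
    rw [ENNReal.tsum_mul_right]
    exact ENNReal.mul_ne_top (hφN x) (ENNReal.mul_ne_top hSt hψA)
  · have hcoef : ∀ k : ℤ, ∫ u, ψ (u - k) * P.eval u
        = ∑ i ∈ Finset.range r, a i * ∑ ν ∈ Finset.range (i + 1),
          (i.choose ν : ℝ) * (k - x) ^ (i - ν) * continuousMoment ν ψ := by
      intro k
      rw [← integral_add_right_eq_self (fun u => ψ (u - k) * P.eval u) (k : ℝ)]
      have h1 : ∀ u, ψ (u + k - k) * P.eval (u + k)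
          = ∑ i ∈ Finset.range r, ∑ ν ∈ Finset.range (i + 1),
            (a i * ((i.choose ν : ℝ) * (k - x) ^ (i - ν))) * (u ^ ν * ψ u) := by
        intro u
        rw [hPe, add_sub_cancel_right, Finset.mul_sum]
        refine Finset.sum_congr rfl fun i _ => ?_
        rw [add_sub_assoc, add_pow, Finset.mul_sum, Finset.mul_sum]
        exact Finset.sum_congr rfl fun ν _ => by ring
      simp only [h1]
      have hint : ∀ i ∈ Finset.range r, ∀ ν ∈ Finset.range (i + 1), Integrable fun u =>
          (a i * ((i.choose ν : ℝ) * (k - x) ^ (i - ν))) * (u ^ ν * ψ u) := by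
        intro i hi ν hν
        have h2 := Finset.mem_range.1 hi
        have h3 := Finset.mem_range.1 hν
        exact (hψi ν (by omega)).const_mul _
      rw [integral_finsetSum _ fun i hi => integrable_finsetSum _ (hint i hi)]
      refine Finset.sum_congr rfl fun i hi => ?_
      rw [integral_finsetSum _ (hint i hi), Finset.mul_sum]
      refine Finset.sum_congr rfl fun ν _ => ?_
      rw [integral_const_mul, continuousMoment]
      ring
    have hsum : ∀ i ∈ Finset.range r, ∀ ν ∈ Finset.range (i + 1), Summable fun k : ℤ =>
        (a i * ((i.choose ν : ℝ) * continuousMoment ν ψ)) * (φ (x - k) * (k - x) ^ (i - ν)) := by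
      intro i hi ν hν
      have h2 := Finset.mem_range.1 hi
      exact (hφs (i - ν) (by omega) x).mul_left _
    have h1 : sampleOp φ ψ (fun u => P.eval u) x
        = ∑ i ∈ Finset.range r, a i * ∑ ν ∈ Finset.range (i + 1),
          (i.choose ν : ℝ) * discreteMoment (i - ν) φ x * continuousMoment ν ψ := by
      have h2 : ∀ k : ℤ, φ (x - k) * ∫ u, ψ (u - k) * P.eval u
          = ∑ i ∈ Finset.range r, ∑ ν ∈ Finset.range (i + 1),
            (a i * ((i.choose ν : ℝ) * continuousMoment ν ψ)) *
              (φ (x - k) * (k - x) ^ (i - ν)) := by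
        intro k
        rw [hcoef, Finset.mul_sum]
        refine Finset.sum_congr rfl fun i _ => ?_
        rw [Finset.mul_sum, Finset.mul_sum]
        exact Finset.sum_congr rfl fun ν _ => by ring
      rw [sampleOp]
      simp only [h2]
      rw [Summable.tsum_finsetSum fun i hi => summable_sum (hsum i hi)]
      refine Finset.sum_congr rfl fun i hi => ?_
      rw [Summable.tsum_finsetSum (hsum i hi), Finset.mul_sum]
      refine Finset.sum_congr rfl fun ν _ => ?_
      rw [tsum_mul_left, discreteMoment]
      ring
    rw [h1, Finset.sum_eq_single_of_mem 0 (Finset.mem_range.2 hr)]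
    · have h3 : discreteMoment 0 φ x = 1 := hφ0 x
      have h4 : continuousMoment 0 ψ = 1 := hψ0
      have h5 : P.eval x = a 0 := by
        rw [hPe, Finset.sum_eq_single_of_mem 0 (Finset.mem_range.2 hr)]
        · simp
        · intro i _ hi; simp [hi]
      simp [h3, h4, h5]
    · intro i hi h0
      rw [hii i (by omega) (Finset.mem_range.1 hi) x, mul_zero]

end

section

variable {r : ℕ} {p : ℝ≥0∞}

/-! ### Kernel bounds from decay -/

theorem exists_tsum_one_add_abs_rpow_le {s : ℝ} (hs : 1 < s) :
    ∃ D : ℝ≥0∞, D ≠ ⊤ ∧ ∀ x : ℝ, ∑' k : ℤ, ENNReal.ofReal ((1 + |x - k|) ^ (-s)) ≤ D := by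
  have h1 : Summable fun k : ℤ => (2 : ℝ) ^ s * (|(k : ℝ)| ^ (-s) + if k = 0 then 1 else 0) := by
    refine ((Real.summable_abs_int_rpow hs).add ?_).mul_left _
    exact summable_of_ne_finset_zero (s := {0}) fun k hk => by simpa using hk
  refine ⟨∑' k : ℤ, ENNReal.ofReal ((2 : ℝ) ^ s * (|(k : ℝ)| ^ (-s) + if k = 0 then 1 else 0)),
    h1.tsum_ofReal_ne_top, fun x => ?_⟩
  rw [← (Equiv.addRight ⌊x⌋).tsum_eq]
  refine ENNReal.tsum_le_tsum fun k => ENNReal.ofReal_le_ofReal ?_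
  have h2 : x - ((Equiv.addRight ⌊x⌋ k : ℤ) : ℝ) = Int.fract x - k := by
    simp only [Equiv.coe_addRight, Int.cast_add, Int.fract]; ring
  rw [h2]
  have hf0 := Int.fract_nonneg x
  have hf1 := Int.fract_lt_one x
  have h3 : (1 + |(k : ℝ)|) / 2 ≤ 1 + |Int.fract x - k| := by
    have h4 : |(k : ℝ)| ≤ |Int.fract x - k| + |Int.fract x| := by
      have := abs_sub (Int.fract x) (Int.fract x - k)
      rw [sub_sub_cancel] at this
      linarith
    rw [abs_of_nonneg hf0] at h4
    linarith [abs_nonneg (Int.fract x - k)]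
  have h5 : (1 + |Int.fract x - k|) ^ (-s) ≤ 2 ^ s * (1 + |(k : ℝ)|) ^ (-s) := by
    calc _ ≤ ((1 + |(k : ℝ)|) / 2) ^ (-s) :=
          Real.rpow_le_rpow_of_nonpos (by positivity) h3 (by linarith)
      _ = _ := by
        rw [Real.div_rpow (by positivity) (by norm_num), Real.rpow_neg (by norm_num : (0:ℝ) ≤ 2),
          div_inv_eq_mul, mul_comm]
  refine h5.trans (mul_le_mul_of_nonneg_left ?_ (by positivity))
  by_cases hk : k = 0
  · subst hk
    simp only [Int.cast_zero, abs_zero, add_zero, Real.one_rpow, if_true]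
    linarith [Real.rpow_nonneg (le_refl (0 : ℝ)) (-s)]
  · have hk' : 0 < |(k : ℝ)| := by positivity
    simp only [hk, if_false, add_zero]
    exact Real.rpow_le_rpow_of_nonpos hk' (by linarith) (by linarith)

theorem DecaysLike.exists_bound {θ : ℝ} {ξ : ℝ → ℝ} (h : DecaysLike θ ξ) :
    ∃ R C : ℝ, 1 ≤ R ∧ 0 ≤ C ∧ ∀ u, R ≤ |u| → |ξ u| ≤ C * |u| ^ (-θ) := by
  obtain ⟨C, hC0, hC⟩ := h.exists_nonneg
  rw [Asymptotics.isBigOWith_iff, ← Metric.cobounded_eq_cocompact,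
    (Metric.hasBasis_cobounded_compl_closedBall (0 : ℝ)).eventually_iff] at hC
  obtain ⟨R, -, hR⟩ := hC
  refine ⟨max 1 (R + 1), C, le_max_left _ _, hC0, fun u hu => ?_⟩
  have h1 : u ∈ (Metric.closedBall (0 : ℝ) R)ᶜ := by
    rw [Set.mem_compl_iff, mem_closedBall_zero_iff, Real.norm_eq_abs]
    linarith [le_max_right 1 (R + 1)]
  have := hR h1
  rwa [Real.norm_eq_abs (ξ u), Real.norm_of_nonneg (by positivity)] at this

theorem DecaysLike.enorm_mul_weight_le {θ : ℝ} {ξ : ℝ → ℝ} (h : DecaysLike θ ξ) (r : ℕ)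
    (hθ : 0 ≤ θ) :
    ∃ R C : ℝ, 1 ≤ R ∧ 0 ≤ C ∧ ∀ u, R ≤ |u| →
      ‖ξ u‖ₑ * weight r u ≤ ENNReal.ofReal (C * (1 + |u|) ^ (-(θ - r))) := by
  obtain ⟨R, C, hR, hC, hb⟩ := h.exists_bound
  refine ⟨R, C * 2 ^ θ, hR, by positivity, fun u hu => ?_⟩
  rw [weight, ← ofReal_norm, Real.norm_eq_abs, ← ENNReal.ofReal_mul (abs_nonneg _)]
  refine ENNReal.ofReal_le_ofReal ?_
  have h0 : 0 < 1 + |u| := by positivity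
  have h1 : |u| ^ (-θ) ≤ 2 ^ θ * (1 + |u|) ^ (-θ) := by
    calc _ ≤ ((1 + |u|) / 2) ^ (-θ) :=
          Real.rpow_le_rpow_of_nonpos (by positivity) (by linarith) (by linarith)
      _ = _ := by
        rw [Real.div_rpow (by positivity) (by norm_num), Real.rpow_neg (by norm_num : (0:ℝ) ≤ 2),
          div_inv_eq_mul, mul_comm]
  calc |ξ u| * (1 + |u|) ^ r ≤ (C * (2 ^ θ * (1 + |u|) ^ (-θ))) * (1 + |u|) ^ r := by
        gcongr
        exact (hb u hu).trans (by gcongr)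
    _ = C * 2 ^ θ * ((1 + |u|) ^ (-θ) * (1 + |u|) ^ r) := by ring
    _ = _ := by
      rw [← Real.rpow_natCast, ← Real.rpow_add h0]
      congr 2; ring

theorem weight_le_of_abs_le {R u : ℝ} (h : |u| ≤ R) : weight r u ≤ weight r R := by
  unfold weight
  exact ENNReal.ofReal_le_ofReal
    (pow_le_pow_left₀ (by positivity) (by linarith [le_abs_self R]) r)

theorem DecaysLike.lintegral_mul_weight_ne_top {θ : ℝ} {ξ : ℝ → ℝ} (h : DecaysLike θ ξ)
    (hξ : MemLp ξ 1 volume) (hθ : (r : ℝ) + 1 < θ) : ∫⁻ u, ‖ξ u‖ₑ * weight r u ≠ ⊤ := by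
  have hr0 : (0 : ℝ) ≤ r := r.cast_nonneg
  obtain ⟨R, C, hR, hC, hb⟩ := h.enorm_mul_weight_le r (by linarith)
  have h1 : ∀ u, ‖ξ u‖ₑ * weight r u
      ≤ ‖ξ u‖ₑ * weight r R + ENNReal.ofReal (C * (1 + ‖u‖) ^ (-(θ - r))) := by
    intro u
    rcases le_total R |u| with hu | hu
    · exact (hb u hu).trans le_add_self
    · exact (mul_le_mul' le_rfl (weight_le_of_abs_le hu)).trans le_self_add
  refine ne_top_of_le_ne_top ?_ (lintegral_mono h1)
  have hm : Measurable fun u : ℝ => ENNReal.ofReal (C * (1 + ‖u‖) ^ (-(θ - r))) := by fun_prop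
  rw [lintegral_add_right _ hm, lintegral_mul_const' _ _ (weight_ne_top _ _)]
  refine ENNReal.add_ne_top.2 ⟨ENNReal.mul_ne_top ?_ (weight_ne_top _ _), ?_⟩
  · have := hξ.2.ne
    rwa [eLpNorm_one_eq_lintegral_enorm] at this
  · have h2 : Integrable (fun u : ℝ => C * (1 + ‖u‖) ^ (-(θ - r))) :=
      (integrable_one_add_norm (by simp; linarith)).const_mul C
    exact h2.lintegral_lt_top.ne

theorem DecaysLike.enorm_mul_weight_le_of_bounded {θ : ℝ} {ξ : ℝ → ℝ} (h : DecaysLike θ ξ) (r : ℕ)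
    (hθ : (r : ℝ) ≤ θ) {B : ℝ} (hB : ∀ u, |ξ u| ≤ B) :
    ∃ C : ℝ, 0 ≤ C ∧ ∀ u,
      ‖ξ u‖ₑ * weight r u ≤ ENNReal.ofReal (C * (1 + |u|) ^ (-(θ - r))) := by
  have hr0 : (0 : ℝ) ≤ r := r.cast_nonneg
  obtain ⟨R, C, hR, hC, hb⟩ := h.enorm_mul_weight_le r (by linarith)
  have hB0 : 0 ≤ B := (abs_nonneg _).trans (hB 0)
  set s := θ - r with hs
  have hs0 : 0 ≤ s := by linarith
  set E : ℝ := B * (1 + R) ^ r * (1 + R) ^ s with hE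
  have hE0 : 0 ≤ E := by positivity
  refine ⟨C + E, by positivity, fun u => ?_⟩
  have h0 : 0 < 1 + |u| := by positivity
  rcases le_total R |u| with hu | hu
  · refine (hb u hu).trans (ENNReal.ofReal_le_ofReal ?_)
    gcongr
    linarith
  · rw [weight, ← ofReal_norm, Real.norm_eq_abs, ← ENNReal.ofReal_mul (abs_nonneg _)]
    refine ENNReal.ofReal_le_ofReal ?_
    have h2 : 1 ≤ (1 + R) ^ s * (1 + |u|) ^ (-s) := by
      rw [Real.rpow_neg h0.le, ← div_eq_mul_inv, one_le_div (by positivity)]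
      gcongr
    calc |ξ u| * (1 + |u|) ^ r ≤ B * (1 + R) ^ r := by gcongr; exact hB u
      _ ≤ B * (1 + R) ^ r * ((1 + R) ^ s * (1 + |u|) ^ (-s)) :=
          le_mul_of_one_le_right (by positivity) h2
      _ = E * (1 + |u|) ^ (-s) := by rw [hE]; ring
      _ ≤ _ := by gcongr; linarith

theorem DecaysLike.exists_tsum_mul_weight_le {θ : ℝ} {ξ : ℝ → ℝ} (h : DecaysLike θ ξ)
    (hθ : (r : ℝ) + 1 < θ) {B : ℝ} (hB : ∀ u, |ξ u| ≤ B) :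
    ∃ D : ℝ≥0∞, D ≠ ⊤ ∧ ∀ x : ℝ, ∑' k : ℤ, ‖ξ (x - k)‖ₑ * weight r (x - k) ≤ D := by
  obtain ⟨C, hC, hb⟩ := h.enorm_mul_weight_le_of_bounded r (by linarith) hB
  obtain ⟨D, hD, hDx⟩ := exists_tsum_one_add_abs_rpow_le (s := θ - r) (by linarith)
  refine ⟨ENNReal.ofReal C * D, ENNReal.mul_ne_top ENNReal.ofReal_ne_top hD, fun x => ?_⟩
  refine (ENNReal.tsum_le_tsum fun k : ℤ => hb (x - k)).trans ?_
  simp only [ENNReal.ofReal_mul hC]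
  rw [ENNReal.tsum_mul_left]
  exact mul_le_mul' le_rfl (hDx x)

theorem DecaysLike.bounded_of_continuous {θ : ℝ} (hθ : 0 ≤ θ) {ξ : ℝ → ℝ} (h : DecaysLike θ ξ)
    (hξ : Continuous ξ) : ∃ B, ∀ u, |ξ u| ≤ B := by
  obtain ⟨R, C, hR, hC, hb⟩ := h.exists_bound
  obtain ⟨B, hB⟩ := (isCompact_Icc (a := -R) (b := R)).exists_bound_of_continuousOn hξ.continuousOn
  refine ⟨max B C, fun u => ?_⟩
  rcases le_total R |u| with hu | hu
  · refine (hb u hu).trans (le_max_of_le_right ?_)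
    exact mul_le_of_le_one_right hC
      (Real.rpow_le_one_of_one_le_of_nonpos (hR.trans hu) (by linarith))
  · exact (hB u (abs_le.1 hu)).trans (le_max_left _ _)

theorem tsum_enorm_le_absMoment (ξ : ℝ → ℝ) (u : ℝ) :
    ∑' k : ℤ, ‖ξ (u - k)‖ₑ ≤ absMoment 0 ξ := by
  unfold absMoment
  refine le_trans (le_of_eq (tsum_congr fun k => ?_))
    (le_iSup (fun u : ℝ => ∑' k : ℤ, ENNReal.ofReal (|ξ (u - k)| * |u - k| ^ (0 : ℝ))) u)
  rw [Real.rpow_zero, mul_one, ← Real.norm_eq_abs, ofReal_norm]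

theorem bounded_of_absMoment_lt_top {ξ : ℝ → ℝ} (h : absMoment 0 ξ < ⊤) :
    ∃ B, ∀ u, |ξ u| ≤ B := by
  refine ⟨(absMoment 0 ξ).toReal, fun u => ?_⟩
  have h1 := (ENNReal.le_tsum (f := fun k : ℤ => ‖ξ (u - k)‖ₑ) 0).trans
    (tsum_enorm_le_absMoment ξ u)
  simp only [Int.cast_zero, sub_zero] at h1
  have := ENNReal.toReal_mono h.ne h1
  simpa using this

theorem exists_leftBound {θ : ℝ} {ξ : ℝ → ℝ} (h : DecaysLike θ ξ) (hξ : MemLp ξ 1 volume)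
    (hθ : (r : ℝ) + 1 < θ) (hB : p ≠ 1 → ∃ B, ∀ u, |ξ u| ≤ B) :
    ∃ N : ℝ≥0∞, N ≠ ⊤ ∧ LeftBound r p ξ N := by
  have h1 := h.lintegral_mul_weight_ne_top hξ hθ
  by_cases hp : p = 1
  · exact ⟨_, h1, le_rfl, fun h => absurd hp h⟩
  · obtain ⟨B, hB⟩ := hB hp
    obtain ⟨D, hD, hDx⟩ := h.exists_tsum_mul_weight_le hθ hB
    exact ⟨_, ENNReal.add_ne_top.2 ⟨h1, hD⟩, le_self_add, fun _ x => (hDx x).trans le_add_self⟩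

/-- The bound for `ψ` passes to a function `ψ'` that agrees with `ψ` almost everywhere. -/
theorem exists_rightBound {θ : ℝ} {ψ ψ' : ℝ → ℝ} (h : DecaysLike θ ψ) (hψ : MemLp ψ 1 volume)
    (hθ : (r : ℝ) + 1 < θ) (hM : p ≠ ⊤ → absMoment 0 ψ < ⊤) (hae : ψ =ᵐ[volume] ψ') :
    ∃ A : ℝ≥0∞, A ≠ ⊤ ∧ RightBound r p ψ' A := by
  have h1 := h.lintegral_mul_weight_ne_top hψ hθ
  have h2 : ∫⁻ u, ‖ψ' u‖ₑ * weight r u = ∫⁻ u, ‖ψ u‖ₑ * weight r u :=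
    lintegral_congr_ae (by filter_upwards [hae] with u hu; rw [hu])
  have h3 : ∀ k : ℤ, ∀ᵐ u : ℝ, ψ (u - k) = ψ' (u - k) := fun k =>
    (measurePreserving_sub_right volume (k : ℝ)).quasiMeasurePreserving.ae hae
  have h4 : ∀ᵐ u : ℝ, ∑' k : ℤ, ‖ψ' (u - k)‖ₑ ≤ absMoment 0 ψ := by
    filter_upwards [ae_all_iff.2 h3] with u hu
    simp only [← hu]
    exact tsum_enorm_le_absMoment ψ u
  by_cases hp : p = ⊤
  · exact ⟨_, h1, h2.le, fun h => absurd hp h⟩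
  · refine ⟨_, ENNReal.add_ne_top.2 ⟨h1, (hM hp).ne⟩, h2.le.trans le_self_add, fun _ => ?_⟩
    filter_upwards [h4] with u hu using hu.trans le_add_self

theorem decaysLike_of_hasCompactSupport {ψ : ℝ → ℝ} (h : HasCompactSupport ψ) (θ : ℝ) :
    DecaysLike θ ψ := by
  have : ψ =ᶠ[cocompact ℝ] fun _ => 0 := by
    filter_upwards [h.compl_mem_cocompact] with u hu
    exact image_eq_zero_of_notMem_tsupport hu
  exact this.trans_isBigO (Asymptotics.isBigO_zero _ _)

/-! ### Differences of the kernel -/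

/-- The average of `b` over the segment from `x` to `x + t`. -/
noncomputable def segAvg (t : ℝ) (b : ℝ → ℝ≥0∞) (x : ℝ) : ℝ≥0∞ :=
  ∫⁻ s in Set.Ioc (0 : ℝ) 1, b (x + t * s)

theorem measurable_segAvg (t : ℝ) {b : ℝ → ℝ≥0∞} (hb : Measurable b) : Measurable (segAvg t b) := by
  have : Measurable (Function.uncurry fun x s : ℝ => b (x + t * s)) := hb.comp (by fun_prop)
  exact this.lintegral_prod_right'

theorem measurable_segAvg_iterate (n : ℕ) (t : ℝ) {b : ℝ → ℝ≥0∞} (hb : Measurable b) :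
    Measurable ((segAvg t)^[n] b) := by
  induction n with
  | zero => exact hb
  | succ n ih => rw [Function.iterate_succ_apply']; exact measurable_segAvg t ih

theorem weight_le_two_pow_mul (r : ℕ) {x t : ℝ} (ht : |t| ≤ 1) :
    weight r x ≤ 2 ^ r * weight r (x + t) := by
  have h2 : (2 : ℝ≥0∞) ^ r = ENNReal.ofReal (2 ^ r) := by
    rw [ENNReal.ofReal_pow (by norm_num)]; simp
  rw [weight, weight, h2, ← ENNReal.ofReal_mul (by positivity), ← mul_pow]
  refine ENNReal.ofReal_le_ofReal ?_
  gcongr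
  have := abs_sub (x + t) t
  rw [add_sub_cancel_right] at this
  linarith [abs_nonneg (x + t)]

theorem abs_mul_le_one_of_mem_Ioc {t s : ℝ} (ht : |t| ≤ 1) (hs : s ∈ Set.Ioc (0 : ℝ) 1) :
    |t * s| ≤ 1 := by
  rw [abs_mul, abs_of_pos hs.1]
  nlinarith [hs.1, hs.2, abs_nonneg t]

theorem lintegral_segAvg_mul_weight_le {t : ℝ} (ht : |t| ≤ 1) {b : ℝ → ℝ≥0∞} (hb : Measurable b) :
    ∫⁻ x, segAvg t b x * weight r x ≤ 2 ^ r * ∫⁻ x, b x * weight r x := by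
  have hm : Measurable fun x => b x * weight r x := hb.mul (measurable_weight r)
  have hm2 : Measurable (Function.uncurry fun x s : ℝ => b (x + t * s) * weight r (x + t * s)) :=
    hm.comp (g := fun x => b x * weight r x) (by fun_prop)
  calc ∫⁻ x, segAvg t b x * weight r x
      ≤ ∫⁻ x, ∫⁻ s in Set.Ioc (0 : ℝ) 1, 2 ^ r * (b (x + t * s) * weight r (x + t * s)) := by
        refine lintegral_mono fun x => ?_
        rw [segAvg, ← lintegral_mul_const' _ _ (weight_ne_top r x)]
        refine setLIntegral_mono' measurableSet_Ioc fun s hs => ?_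
        calc _ ≤ b (x + t * s) * (2 ^ r * weight r (x + t * s)) :=
              mul_le_mul' le_rfl (weight_le_two_pow_mul r (abs_mul_le_one_of_mem_Ioc ht hs))
          _ = _ := by ring
    _ = ∫⁻ s in Set.Ioc (0 : ℝ) 1, ∫⁻ x, 2 ^ r * (b (x + t * s) * weight r (x + t * s)) :=
        lintegral_lintegral_swap (hm2.const_mul _).aemeasurable
    _ = ∫⁻ s in Set.Ioc (0 : ℝ) 1, 2 ^ r * ∫⁻ x, b x * weight r x := by
        refine lintegral_congr fun s => ?_
        rw [lintegral_const_mul' _ _ (by simp),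
          lintegral_add_right_eq_self (fun x => b x * weight r x)]
    _ = _ := by simp

theorem tsum_segAvg_mul_weight_le {t : ℝ} (ht : |t| ≤ 1) {b : ℝ → ℝ≥0∞} (hb : Measurable b)
    {N : ℝ≥0∞} (hN : ∀ x : ℝ, ∑' k : ℤ, b (x - k) * weight r (x - k) ≤ N) (x : ℝ) :
    ∑' k : ℤ, segAvg t b (x - k) * weight r (x - k) ≤ 2 ^ r * N := by
  have hm : ∀ k : ℤ, Measurable fun s : ℝ =>
      2 ^ r * (b (x + t * s - k) * weight r (x + t * s - k)) :=
    fun k => ((hb.comp (by fun_prop)).mul ((measurable_weight r).comp (by fun_prop))).const_mul _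
  calc ∑' k : ℤ, segAvg t b (x - k) * weight r (x - k)
      ≤ ∑' k : ℤ, ∫⁻ s in Set.Ioc (0 : ℝ) 1,
          2 ^ r * (b (x + t * s - k) * weight r (x + t * s - k)) := by
        refine ENNReal.tsum_le_tsum fun k => ?_
        rw [segAvg, ← lintegral_mul_const' _ _ (weight_ne_top r _)]
        refine setLIntegral_mono' measurableSet_Ioc fun s hs => ?_
        have := weight_le_two_pow_mul r (x := x - k) (abs_mul_le_one_of_mem_Ioc ht hs)
        rw [sub_add_eq_add_sub] at this ⊢
        calc _ ≤ b (x + t * s - k) * (2 ^ r * weight r (x + t * s - k)) :=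
              mul_le_mul' le_rfl this
          _ = _ := by ring
    _ = ∫⁻ s in Set.Ioc (0 : ℝ) 1, ∑' k : ℤ,
          2 ^ r * (b (x + t * s - k) * weight r (x + t * s - k)) :=
        (lintegral_tsum fun k => (hm k).aemeasurable).symm
    _ ≤ ∫⁻ _ in Set.Ioc (0 : ℝ) 1, 2 ^ r * N := by
        refine lintegral_mono fun s => ?_
        rw [ENNReal.tsum_mul_left]
        exact mul_le_mul' le_rfl (hN _)
    _ = _ := by simp

theorem IterPrim.enorm_finDiff_le {n : ℕ} {g G : ℝ → ℝ} (hg : IterPrim n g G) (t x : ℝ) :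
    ‖finDiff n t g x‖ₑ ≤ ENNReal.ofReal (|t| ^ n) * (segAvg t)^[n] (fun y => ‖G y‖ₑ) x := by
  induction n generalizing g x with
  | zero => rw [show g = G from hg]; simp [finDiff_zero]
  | succ n ih =>
    obtain ⟨g', hi, hgi, hgn⟩ := hg
    have h1 : ∀ y, g (y + t) - g y = t * Durrmeyer.steklov t g' y := by
      intro y
      rw [hgi, Durrmeyer.steklov]
      by_cases ht : t = 0
      · simp [ht]
      · rw [intervalIntegral.integral_comp_add_mul _ ht]
        simp [ht]
    have h2 : finDiff (n + 1) t g x = t * ∫ s in (0 : ℝ)..1, finDiff n t g' (x + t * s) := by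
      rw [finDiff_succ]
      simp only [h1, finDiff, Durrmeyer.steklov]
      rw [intervalIntegral.integral_finsetSum, Finset.mul_sum]
      · refine Finset.sum_congr rfl fun j _ => ?_
        rw [intervalIntegral.integral_const_mul]
        simp only [add_right_comm x (t * _)]
        ring
      · intro j _
        refine IntervalIntegrable.const_mul ?_ _
        have := intervalIntegrable_comp_add_mul hi (x + j * t) t 0 1
        simpa only [add_right_comm] using this
    rw [h2, enorm_mul, Function.iterate_succ_apply', segAvg, pow_succ',
      ENNReal.ofReal_mul (abs_nonneg t), ← Real.norm_eq_abs, ofReal_norm, mul_assoc]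
    refine mul_le_mul' le_rfl ((enorm_intervalIntegral_le _ _ _).trans ?_)
    rw [Set.uIoc_of_le zero_le_one, ← lintegral_const_mul' _ _ ENNReal.ofReal_ne_top]
    exact lintegral_mono fun s => ih hgn _

/-- The weighted bounds of the `r`-th difference of a kernel with step `t` are at most a constant
times `|t| ^ r` times those of the `r`-th derivative `G` of the kernel. -/
theorem IterPrim.leftBound_finDiff {g G : ℝ → ℝ} (hg : IterPrim r g G) (hG : Measurable G)
    {N : ℝ≥0∞} (hN : LeftBound r p G N) {t : ℝ} (ht : |t| ≤ 1) :
    LeftBound r p (finDiff r t g) (ENNReal.ofReal (|t| ^ r) * ((2 ^ r) ^ r * N)) := by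
  have hm : ∀ n, Measurable ((segAvg t)^[n] fun y => ‖G y‖ₑ) := fun n =>
    measurable_segAvg_iterate n t hG.enorm
  have h1 : ∀ n : ℕ, ∫⁻ x, (segAvg t)^[n] (fun y => ‖G y‖ₑ) x * weight r x ≤ (2 ^ r) ^ n * N := by
    intro n
    induction n with
    | zero => simpa using hN.lintegral_le
    | succ n ih =>
      rw [Function.iterate_succ_apply', pow_succ', mul_assoc]
      exact (lintegral_segAvg_mul_weight_le ht (hm n)).trans (mul_le_mul' le_rfl ih)
  have h2 : p ≠ 1 → ∀ n : ℕ, ∀ x : ℝ, ∑' k : ℤ,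
      (segAvg t)^[n] (fun y => ‖G y‖ₑ) (x - k) * weight r (x - k) ≤ (2 ^ r) ^ n * N := by
    intro hp n
    induction n with
    | zero => simpa using hN.tsum_le hp
    | succ n ih =>
      intro x
      rw [Function.iterate_succ_apply', pow_succ', mul_assoc]
      exact tsum_segAvg_mul_weight_le ht (hm n) ih x
  constructor
  · calc _ ≤ ∫⁻ x, ENNReal.ofReal (|t| ^ r) *
          ((segAvg t)^[r] (fun y => ‖G y‖ₑ) x * weight r x) := by
          refine lintegral_mono fun x => ?_
          rw [← mul_assoc]
          exact mul_le_mul' (hg.enorm_finDiff_le t x) le_rfl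
      _ ≤ _ := by
          rw [lintegral_const_mul' _ _ ENNReal.ofReal_ne_top]
          exact mul_le_mul' le_rfl (h1 r)
  · intro hp x
    calc _ ≤ ∑' k : ℤ, ENNReal.ofReal (|t| ^ r) *
          ((segAvg t)^[r] (fun y => ‖G y‖ₑ) (x - k) * weight r (x - k)) := by
          refine ENNReal.tsum_le_tsum fun k => ?_
          rw [← mul_assoc]
          exact mul_le_mul' (hg.enorm_finDiff_le t _) le_rfl
      _ ≤ _ := by
          rw [ENNReal.tsum_mul_left]
          exact mul_le_mul' le_rfl (h2 hp r x)

theorem MemSobolev.iterPrim {q : ℝ≥0∞} {g : ℝ → ℝ} (h : MemSobolev r q g) :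
    IterPrim r g (iteratedDeriv r g) := by
  obtain ⟨-, hd', hac, -⟩ := h
  have hd : ContDiff ℝ ((r - 1 : ℕ) : WithTop ℕ∞) g := hd'
  have key : ∀ j ≤ r, IterPrim j (iteratedDeriv (r - j) g) (iteratedDeriv r g) := by
    intro j
    induction j with
    | zero => intro _; rfl
    | succ j ih =>
      intro hj
      have hstep : iteratedDeriv (r - j) g = deriv (iteratedDeriv (r - (j + 1)) g) := by
        rw [← iteratedDeriv_succ]; congr 1; omega
      refine ⟨iteratedDeriv (r - j) g, ?_, ?_, ih (by omega)⟩
      all_goals rw [hstep]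
      · rcases Nat.eq_zero_or_pos j with rfl | hj0
        · exact fun a b => (hac a b).intervalIntegrable_deriv
        · intro a b
          rw [← hstep]
          exact (hd.continuous_iteratedDeriv (r - j)
            (Nat.cast_le.2 (show r - j ≤ r - 1 by omega))).intervalIntegrable
            a b
      · rcases Nat.eq_zero_or_pos j with rfl | hj0
        · exact fun x u => (hac x u).integral_deriv_eq_sub.symm
        · intro x u
          refine (intervalIntegral.integral_deriv_eq_sub (fun y _ => ?_) ?_).symm
          · exact (hd.differentiable_iteratedDeriv (r - (j + 1))
              (Nat.cast_lt.2 (show r - (j + 1) < r - 1 by omega))).differentiableAt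
          · rw [← hstep]
            exact (hd.continuous_iteratedDeriv (r - j)
              (Nat.cast_le.2 (show r - j ≤ r - 1 by omega))).intervalIntegrable x u
  simpa using key r le_rfl

end

section

variable {r : ℕ} {p : ℝ≥0∞} {φ ψ : ℝ → ℝ} {N N' A : ℝ≥0∞}

/-! ### Dilations -/

/-- The Durrmeyer operator with parameter `w` is conjugate to the one with parameter `1`. -/
theorem durrmeyer_eq_sampleOp (φ ψ : ℝ → ℝ) {w : ℝ} (hw : 0 < w) (f : ℝ → ℝ) (x : ℝ) :
    durrmeyer φ ψ w f x = sampleOp φ ψ (fun v => f (w⁻¹ * v)) (w * x) := by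
  refine tsum_congr fun k => ?_
  have h := Measure.integral_comp_mul_left (fun v => ψ (v - k) * f (w⁻¹ * v)) w
  simp only [inv_mul_cancel_left₀ hw.ne'] at h
  rw [h, abs_of_pos (inv_pos.2 hw), smul_eq_mul, mul_inv_cancel_left₀ hw.ne']

theorem ae_comp_const_mul {P : ℝ → Prop} (h : ∀ᵐ x, P x) {w : ℝ} (hw : w ≠ 0) :
    ∀ᵐ x, P (w * x) := by
  have hq : Measure.QuasiMeasurePreserving (fun x : ℝ => w * x) volume volume :=
    ⟨measurable_const_mul w, by
      rw [Real.map_volume_mul_left hw]; exact Measure.smul_absolutelyContinuous⟩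
  exact hq.ae h

theorem durrmeyer_congr_ae (φ : ℝ → ℝ) {ψ ψ' f f' : ℝ → ℝ} (hψ : ψ =ᵐ[volume] ψ')
    (hf : f =ᵐ[volume] f') {w : ℝ} (hw : 0 < w) : durrmeyer φ ψ w f = durrmeyer φ ψ' w f' := by
  ext x
  rw [durrmeyer_eq_sampleOp φ ψ hw, durrmeyer_eq_sampleOp φ ψ' hw]
  refine tsum_congr fun k => ?_
  congr 1
  refine integral_congr_ae ?_
  have h1 : ∀ᵐ u : ℝ, ψ (u - k) = ψ' (u - k) :=
    (measurePreserving_sub_right volume (k : ℝ)).quasiMeasurePreserving.ae hψ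
  filter_upwards [h1, ae_comp_const_mul hf (inv_ne_zero hw.ne')] with u hu1 hu2
  rw [hu1, hu2]

theorem measurable_sampleOp (hφ : Measurable φ) (ψ f : ℝ → ℝ) : Measurable (sampleOp φ ψ f) := by
  unfold sampleOp
  refine Measurable.tsum fun k => ?_
  fun_prop

theorem measurable_durrmeyer (hφ : Measurable φ) (ψ f : ℝ → ℝ) {w : ℝ} (hw : 0 < w) :
    Measurable (durrmeyer φ ψ w f) := by
  rw [funext fun x => durrmeyer_eq_sampleOp φ ψ hw f x]
  exact (measurable_sampleOp hφ ψ _).comp (measurable_const_mul w)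

/-- The factor by which a dilation changes the `L^p` norm. -/
theorem dilation_factor_mul {w : ℝ} (hw : 0 < w) (e : ℝ) (he : 0 ≤ e) :
    ENNReal.ofReal w⁻¹ ^ e * ENNReal.ofReal w ^ e = 1 := by
  rw [← ENNReal.mul_rpow_of_nonneg _ _ he, ← ENNReal.ofReal_mul (by positivity),
    inv_mul_cancel₀ hw.ne']
  simp

theorem memLp_comp_const_mul {f : ℝ → ℝ} (hf : Measurable f) (hfp : MemLp f p volume) {w : ℝ}
    (hw : 0 < w) : MemLp (fun x => f (w * x)) p volume := by
  refine ⟨(hf.comp (measurable_const_mul w)).aestronglyMeasurable, ?_⟩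
  rw [eLpNorm_comp_const_mul hf.aestronglyMeasurable hw]
  exact ENNReal.mul_lt_top (ENNReal.rpow_lt_top_of_nonneg ENNReal.toReal_nonneg
    ENNReal.ofReal_ne_top) hfp.2

theorem lpModulus_comp_inv_mul_le {f : ℝ → ℝ} (hf : Measurable f) {w : ℝ} (hw : 0 < w) :
    ENNReal.ofReal w⁻¹ ^ (1 / p).toReal * lpModulus p r (fun x => f (w⁻¹ * x)) 1
      ≤ lpModulus p r f w⁻¹ := by
  rw [lpModulus, ENNReal.mul_iSup]
  simp only [ENNReal.mul_iSup]
  refine iSup₂_le fun t ht => ?_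
  rw [funext fun x => finDiff_comp_const_mul r t w⁻¹ f x,
    eLpNorm_comp_const_mul (measurable_finDiff r _ hf).aestronglyMeasurable (inv_pos.2 hw),
    inv_inv, ← mul_assoc, dilation_factor_mul hw _ ENNReal.toReal_nonneg, one_mul]
  refine eLpNorm_finDiff_le_lpModulus p r f ?_
  rw [abs_mul, abs_of_pos (inv_pos.2 hw)]
  exact mul_le_of_le_one_right (inv_pos.2 hw).le ht

/-! ### Jackson and Bernstein type inequalities for the Durrmeyer operator -/

/-- The Jackson type inequality. -/
theorem eLpNorm_durrmeyer_sub_le (hr : 1 ≤ r) (hp : 1 ≤ p) (hφ : Measurable φ) (hψ : Measurable ψ)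
    (hN : LeftBound r p φ N) (hA : RightBound r p ψ A) (hrep : Reproduces r φ ψ 1)
    {f : ℝ → ℝ} (hf : Measurable f) (hfp : MemLp f p volume) {w : ℝ} (hw : 0 < w) :
    eLpNorm (fun x => durrmeyer φ ψ w f x - f x) p volume
      ≤ (N * A * (1 + ENNReal.ofReal ((2 * r) ^ r)) + 1) * lpModulus p r f w⁻¹ := by
  set F : ℝ → ℝ := fun v => f (w⁻¹ * v) with hF
  have hFm : Measurable F := hf.comp (measurable_const_mul _)
  have hFp : MemLp F p volume := memLp_comp_const_mul hf hfp (inv_pos.2 hw)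
  set h : ℝ → ℝ := fun x => sampleOp φ ψ F x - 1 * F x with hh
  have hhm : Measurable h := (measurable_sampleOp hφ ψ F).sub (hFm.const_mul 1)
  have h1 : (fun x => durrmeyer φ ψ w f x - f x) = fun x => h (w * x) := by
    ext x
    rw [durrmeyer_eq_sampleOp φ ψ hw]
    simp only [hh, hF, one_mul, inv_mul_cancel_left₀ hw.ne']
  have h2 := eLpNorm_sampleOp_sub_le hr hp hφ hψ hN hA hrep hFm hFp
  rw [enorm_one] at h2
  rw [h1, eLpNorm_comp_const_mul hhm.aestronglyMeasurable hw]
  calc _ ≤ ENNReal.ofReal w⁻¹ ^ (1 / p).toReal *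
        ((N * A * (1 + ENNReal.ofReal ((2 * r) ^ r)) + 1) * lpModulus p r F 1) := by gcongr
    _ = (N * A * (1 + ENNReal.ofReal ((2 * r) ^ r)) + 1) *
        (ENNReal.ofReal w⁻¹ ^ (1 / p).toReal * lpModulus p r F 1) := by ring
    _ ≤ _ := mul_le_mul' le_rfl (lpModulus_comp_inv_mul_le hf hw)

theorem ae_lt_top_of_eLpNorm_ne_top (hp : 1 ≤ p) {F : ℝ → ℝ≥0∞} (hF : Measurable F)
    (h : eLpNorm F p volume ≠ ⊤) : ∀ᵐ x, F x < ⊤ := by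
  by_cases hpt : p = ⊤
  · subst hpt
    rw [eLpNorm_exponent_top] at h
    filter_upwards [enorm_ae_le_eLpNormEssSup F volume] with x hx
    exact hx.trans_lt h.lt_top
  · have hp0 : p ≠ 0 := by rintro rfl; simp at hp
    have h1 := lintegral_rpow_enorm_lt_top_of_eLpNorm_lt_top hp0 hpt h.lt_top
    have hpos := ENNReal.toReal_pos hp0 hpt
    simp only [enorm_eq_self] at h1
    filter_upwards [ae_lt_top (hF.pow_const _) h1.ne] with x hx
    exact (ENNReal.rpow_lt_top_iff_of_pos hpos).1 hx

/-- The Bernstein type inequality, in terms of differences: the difference of order `r` of the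
Durrmeyer operator is a sampling operator that annihilates polynomials of degree less than `r`, and
its kernel has bounds of size `(|t| w) ^ r`. -/
theorem eLpNorm_finDiff_durrmeyer_le (hr : 1 ≤ r) (hp : 1 ≤ p) (hφ : Measurable φ)
    (hψ : Measurable ψ) (hN : LeftBound r p φ N) (hNt : N ≠ ⊤) {Φ : ℝ → ℝ} (hΦ : Measurable Φ)
    (hφΦ : IterPrim r φ Φ) (hN' : LeftBound r p Φ N') (hA : RightBound r p ψ A) (hAt : A ≠ ⊤)
    (hrep : Reproduces r φ ψ 1)
    {f : ℝ → ℝ} (hf : Measurable f) (hfp : MemLp f p volume) {w : ℝ} (hw : 0 < w) {t : ℝ}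
    (ht : |t| * w ≤ 1) :
    eLpNorm (finDiff r t (durrmeyer φ ψ w f)) p volume
      ≤ (2 ^ r) ^ r * N' * A * (1 + ENNReal.ofReal ((2 * r) ^ r)) *
        (ENNReal.ofReal ((|t| * w) ^ r) * lpModulus p r f w⁻¹) := by
  set F : ℝ → ℝ := fun v => f (w⁻¹ * v) with hF
  have hFm : Measurable F := hf.comp (measurable_const_mul _)
  have hFp : MemLp F p volume := memLp_comp_const_mul hf hfp (inv_pos.2 hw)
  have habs : |w * t| = |t| * w := by rw [abs_mul, abs_of_pos hw, mul_comm]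
  set χ := finDiff r (w * t) φ with hχ
  have hχm : Measurable χ := measurable_finDiff r _ hφ
  have hNχ := hφΦ.leftBound_finDiff hΦ hN' (t := w * t) (by rw [habs]; exact ht)
  have hfin : ∀ᵐ x, posOp φ ψ (fun u => ‖F u‖ₑ) x < ⊤ := by
    refine ae_lt_top_of_eLpNorm_ne_top hp (measurable_posOp hφ ψ _) (ne_top_of_le_ne_top ?_
      (eLpNorm_posOp_le hp hφ hψ hN hA hFm.enorm))
    rw [eLpNorm_enorm]
    exact ENNReal.mul_ne_top (ENNReal.mul_ne_top hNt hAt) hFp.2.ne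
  have hfin' : ∀ᵐ x, ∀ j : ℕ, posOp φ ψ (fun u => ‖F u‖ₑ) (x + j * (w * t)) < ⊤ :=
    ae_all_iff.2 fun j => (measurePreserving_add_right volume
      ((j : ℝ) * (w * t))).quasiMeasurePreserving.ae hfin
  have h1 : finDiff r t (durrmeyer φ ψ w f)
      = fun x => finDiff r (w * t) (sampleOp φ ψ F) (w * x) := by
    rw [funext fun x => durrmeyer_eq_sampleOp φ ψ hw f x]
    ext x
    rw [finDiff_comp_const_mul]
  have h2 : finDiff r (w * t) (sampleOp φ ψ F)
      =ᵐ[volume] fun x => sampleOp χ ψ F x - 0 * F x := by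
    filter_upwards [hfin'] with x hx
    rw [← sampleOp_finDiff r (w * t) fun j _ => (hx j).ne, zero_mul, sub_zero]
  have h3 := eLpNorm_sampleOp_sub_le hr hp hχm hψ hNχ hA (hrep.finDiff (w * t)) hFm hFp
  rw [enorm_zero, add_zero, habs] at h3
  rw [h1, eLpNorm_comp_const_mul
    (measurable_finDiff r _ (measurable_sampleOp hφ ψ F)).aestronglyMeasurable hw,
    eLpNorm_congr_ae h2]
  calc _ ≤ ENNReal.ofReal w⁻¹ ^ (1 / p).toReal * (ENNReal.ofReal ((|t| * w) ^ r) *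
        ((2 ^ r) ^ r * N') * A * (1 + ENNReal.ofReal ((2 * r) ^ r)) * lpModulus p r F 1) :=
        mul_le_mul' le_rfl h3
    _ = (2 ^ r) ^ r * N' * A * (1 + ENNReal.ofReal ((2 * r) ^ r)) *
        (ENNReal.ofReal ((|t| * w) ^ r) *
          (ENNReal.ofReal w⁻¹ ^ (1 / p).toReal * lpModulus p r F 1)) := by ring
    _ ≤ _ := mul_le_mul' le_rfl (mul_le_mul' le_rfl (lpModulus_comp_inv_mul_le hf hw))

theorem exists_one_lt_mul_inv_pow_le {α C : ℝ} (hαr : α < r) :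
    ∃ a : ℝ, 1 < a ∧ C * a⁻¹ ^ r ≤ 1 / 2 * a ^ (-α) := by
  have h1 : Tendsto (fun a : ℝ => a ^ ((r : ℝ) - α)) atTop atTop :=
    tendsto_rpow_atTop (by linarith)
  obtain ⟨a, ha, ha1⟩ := ((h1.eventually_ge_atTop (2 * C)).and (eventually_gt_atTop 1)).exists
  have ha0 : 0 < a := by linarith
  refine ⟨a, ha1, ?_⟩
  have h2 : a ^ (-α) = a ^ ((r : ℝ) - α) * a⁻¹ ^ r := by
    rw [inv_pow, ← Real.rpow_natCast a r, ← Real.rpow_neg ha0.le, ← Real.rpow_add ha0]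
    congr 1; ring
  rw [h2, ← mul_assoc]
  gcongr
  linarith

/-- The equivalence of the Lipschitz condition and the approximation rate, for a measurable
representative `f` and the norm of `L^p`. -/
theorem lpModulus_isBigO_iff_rate (hr : 1 ≤ r) (hp : 1 ≤ p) (hφ : Measurable φ)
    (hψ : Measurable ψ) (hN : LeftBound r p φ N) (hNt : N ≠ ⊤) {Φ : ℝ → ℝ} (hΦ : Measurable Φ)
    (hφΦ : IterPrim r φ Φ) (hN' : LeftBound r p Φ N') (hNt' : N' ≠ ⊤)
    (hA : RightBound r p ψ A) (hAt : A ≠ ⊤) (hrep : Reproduces r φ ψ 1)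
    {α : ℝ} (hα : 0 < α) (hαr : α < r)
    {f : ℝ → ℝ} (hf : Measurable f) (hfp : MemLp f p volume) :
    (∃ C : ℝ, ∀ᶠ δ in 𝓝[>] (0 : ℝ), lpModulus p (⌊α⌋₊ + 1) f δ ≤ ENNReal.ofReal (C * δ ^ α)) ↔
    ∃ C : ℝ, ∀ᶠ w in atTop, eLpNorm (fun x => durrmeyer φ ψ w f x - f x) p volume
      ≤ ENNReal.ofReal (C * w ^ (-α)) := by
  have hm : ⌊α⌋₊ + 1 ≤ r := (Nat.floor_lt hα.le).2 hαr
  obtain ⟨k, hk⟩ := Nat.exists_eq_add_of_le hm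
  have hαm : α < ((⌊α⌋₊ + 1 : ℕ) : ℝ) := by exact_mod_cast Nat.lt_floor_add_one α
  constructor
  · rintro ⟨C, hC⟩
    set D := N * A * (1 + ENNReal.ofReal ((2 * r) ^ r)) + 1 with hD
    have hDt : D ≠ ⊤ := by finiteness
    refine ⟨D.toReal * (2 ^ k * C), ?_⟩
    filter_upwards [tendsto_inv_atTop_nhdsGT_zero.eventually hC, eventually_gt_atTop 0] with w h1 hw
    refine (eLpNorm_durrmeyer_sub_le hr hp hφ hψ hN hA hrep hf hfp hw).trans ?_
    have h2 : lpModulus p r f w⁻¹ ≤ 2 ^ k * ENNReal.ofReal (C * w⁻¹ ^ α) := by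
      rw [hk]
      exact (lpModulus_add_le _ k hp hf.aestronglyMeasurable _).trans (mul_le_mul' le_rfl h1)
    have h3 : (2 : ℝ≥0∞) ^ k = ENNReal.ofReal (2 ^ k) := by
      rw [ENNReal.ofReal_pow (by norm_num)]; simp
    calc _ ≤ D * (2 ^ k * ENNReal.ofReal (C * w⁻¹ ^ α)) := mul_le_mul' le_rfl h2
      _ = _ := by
        rw [h3, ← ENNReal.ofReal_mul (by positivity), ← ENNReal.ofReal_toReal hDt,
          ← ENNReal.ofReal_mul ENNReal.toReal_nonneg, ENNReal.ofReal_toReal hDt,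
          Real.inv_rpow hw.le, Real.rpow_neg hw.le]
        congr 1; ring
  · rintro ⟨M, hM⟩
    refine lpModulus_isBigO_of_add k hp hfp hα hαm ?_
    rw [← hk]
    set D := (2 ^ r) ^ r * N' * A * (1 + ENNReal.ofReal ((2 * r) ^ r)) with hD
    have hDt : D ≠ ⊤ := by finiteness
    obtain ⟨w₀, hw₀⟩ := eventually_atTop.1 hM
    obtain ⟨a, ha1, ha⟩ := exists_one_lt_mul_inv_pow_le (C := D.toReal) hαr
    have ha0 : 0 < a := by linarith
    have hw₀' : 0 < max w₀ 1 := by positivity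
    refine lpModulus_isBigO_of_recursion hp hfp hα ha1 (M := 2 ^ r * |M|) (q := 1 / 2)
      (s₀ := (max w₀ 1)⁻¹) (by positivity) (by norm_num) (by norm_num) (by positivity)
      fun s hs hs₀ => iSup₂_le fun t ht => ?_
    set w := s⁻¹ with hw
    have hw0 : 0 < w := by positivity
    have hww : w₀ ≤ w := (le_max_left _ _).trans ((le_inv_comm₀ hw₀' hs).2 hs₀)
    have htw : |t| * w ≤ a⁻¹ := by
      rw [hw, ← div_eq_mul_inv, div_le_iff₀ hs, mul_comm, ← div_eq_mul_inv]
      exact ht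
    set E : ℝ → ℝ := fun x => durrmeyer φ ψ w f x - f x with hE
    have hDm := measurable_durrmeyer hφ ψ f hw0
    have hEm : Measurable E := hDm.sub hf
    have h1 : finDiff r t f = finDiff r t (durrmeyer φ ψ w f) - finDiff r t E := by
      ext x
      rw [Pi.sub_apply, hE, finDiff_sub, sub_sub_cancel]
    have h2 : eLpNorm (finDiff r t E) p volume ≤ ENNReal.ofReal (2 ^ r * |M| * s ^ α) := by
      have h3 := eLpNorm_finDiff_add_le 0 r t hp hEm.aestronglyMeasurable
      rw [zero_add, finDiff_zero] at h3
      have h4 : (2 : ℝ≥0∞) ^ r = ENNReal.ofReal (2 ^ r) := by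
        rw [ENNReal.ofReal_pow (by norm_num)]; simp
      refine h3.trans ((mul_le_mul' le_rfl (hw₀ w hww)).trans ?_)
      rw [h4, ← ENNReal.ofReal_mul (by positivity)]
      refine ENNReal.ofReal_le_ofReal ?_
      rw [hw, Real.inv_rpow hs.le, Real.rpow_neg hs.le, inv_inv, mul_assoc]
      gcongr
      exact le_abs_self M
    have h5 : eLpNorm (finDiff r t (durrmeyer φ ψ w f)) p volume
        ≤ ENNReal.ofReal (1 / 2 * a ^ (-α)) * lpModulus p r f s := by
      have h6 := eLpNorm_finDiff_durrmeyer_le hr hp hφ hψ hN hNt hΦ hφΦ hN' hA hAt hrep hf hfp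
        hw0 (htw.trans (inv_le_one_of_one_le₀ ha1.le))
      rw [← hD, hw, inv_inv, ← hw] at h6
      refine h6.trans ?_
      rw [← mul_assoc, ← ENNReal.ofReal_toReal hDt, ← ENNReal.ofReal_mul ENNReal.toReal_nonneg]
      refine mul_le_mul' (ENNReal.ofReal_le_ofReal (le_trans ?_ ha)) le_rfl
      gcongr
    rw [h1, add_comm]
    refine (eLpNorm_sub_le (measurable_finDiff r t hDm).aestronglyMeasurable
      (measurable_finDiff r t hEm).aestronglyMeasurable hp).trans (add_le_add h5 h2)

/-! ### The supremum norm -/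

theorem iSup_enorm_eq_eLpNorm_top {g : ℝ → ℝ} (hg : Continuous g) :
    ⨆ x, ‖g x‖ₑ = eLpNorm g ⊤ volume := by
  rw [eLpNorm_exponent_top]
  refine iSup_eq_essSup fun x a hx => ?_
  exact ((isOpen_lt continuous_const hg.enorm).measure_pos volume ⟨x, hx⟩).ne'

theorem continuous_sampleOp {θ : ℝ} (hθ : 1 < θ) (hφ : Continuous φ) (hφθ : DecaysLike θ φ)
    (hψ : MemLp ψ 1 volume) {f : ℝ → ℝ} {B : ℝ} (hB : ∀ x, |f x| ≤ B) :
    Continuous (sampleOp φ ψ f) := by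
  obtain ⟨B', hB'⟩ := hφθ.bounded_of_continuous (by linarith) hφ
  obtain ⟨C, hC0, hC⟩ := hφθ.enorm_mul_weight_le_of_bounded 0 (by simp; linarith) hB'
  obtain ⟨D, hD, hDx⟩ := exists_tsum_one_add_abs_rpow_le hθ
  have hsum : Summable fun k : ℤ => (1 + |(k : ℝ)|) ^ (-θ) := by
    refine summable_of_tsum_enorm_ne_top (ne_top_of_le_ne_top hD ((le_of_eq ?_).trans (hDx 0)))
    refine tsum_congr fun k => ?_
    rw [Real.enorm_of_nonneg (by positivity), zero_sub, abs_neg]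
  have hφb : ∀ u, |φ u| ≤ C * (1 + |u|) ^ (-θ) := by
    intro u
    have := hC u
    simp only [weight, pow_zero, ENNReal.ofReal_one, mul_one, Nat.cast_zero, sub_zero] at this
    rw [← ofReal_norm, Real.norm_eq_abs] at this
    exact (ENNReal.ofReal_le_ofReal_iff (by positivity)).1 this
  have hψi : Integrable ψ := memLp_one_iff_integrable.1 hψ
  set J := ∫ u, ‖ψ u‖ * B with hJ
  have hcoef : ∀ k : ℤ, ‖∫ u, ψ (u - k) * f u‖ ≤ J := by
    intro k
    rw [hJ, ← integral_sub_right_eq_self (fun u => ‖ψ u‖ * B) (k : ℝ)]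
    refine norm_integral_le_of_norm_le ((hψi.comp_sub_right (k : ℝ)).norm.mul_const B)
      (ae_of_all _ fun u => ?_)
    rw [norm_mul]
    gcongr
    exact hB u
  have hJ0 : 0 ≤ J := (norm_nonneg _).trans (hcoef 0)
  rw [continuous_iff_continuousAt]
  intro x
  -- On the unit ball around `x`, `φ (y - k)` decays in `k` uniformly in `y`.
  have hon : ContinuousOn (sampleOp φ ψ f) (Metric.ball x 1) := by
    refine continuousOn_tsum (u := fun k : ℤ => C * (2 + |x|) ^ θ * J * (1 + |(k : ℝ)|) ^ (-θ))
      (fun k => by fun_prop) (hsum.mul_left _) fun k y hy => ?_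
    rw [norm_mul, Real.norm_eq_abs]
    have hyx : |y| ≤ 1 + |x| := by
      rw [Metric.mem_ball, Real.dist_eq] at hy
      have := abs_sub_abs_le_abs_sub y x
      linarith
    have h1 : (1 + |(k : ℝ)|) / (2 + |x|) ≤ 1 + |y - k| := by
      rw [div_le_iff₀ (by positivity)]
      have := abs_sub y (y - k)
      rw [sub_sub_cancel] at this
      nlinarith [abs_nonneg (y - k), abs_nonneg x]
    have h2 : (1 + |y - k|) ^ (-θ) ≤ (2 + |x|) ^ θ * (1 + |(k : ℝ)|) ^ (-θ) := by
      calc _ ≤ ((1 + |(k : ℝ)|) / (2 + |x|)) ^ (-θ) :=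
            Real.rpow_le_rpow_of_nonpos (by positivity) h1 (by linarith)
        _ = _ := by
          rw [Real.div_rpow (by positivity) (by positivity),
            Real.rpow_neg (by positivity : 0 ≤ 2 + |x|),
            div_inv_eq_mul, mul_comm]
    calc |φ (y - k)| * ‖∫ u, ψ (u - k) * f u‖
        ≤ (C * ((2 + |x|) ^ θ * (1 + |(k : ℝ)|) ^ (-θ))) * J := by
          gcongr
          · exact (hφb _).trans (by gcongr)
          · exact hcoef k
      _ = _ := by ring
  exact hon.continuousAt (Metric.ball_mem_nhds x one_pos)

theorem continuous_durrmeyer {θ : ℝ} (hθ : 1 < θ) (hφ : Continuous φ) (hφθ : DecaysLike θ φ)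
    (hψ : MemLp ψ 1 volume) {f : ℝ → ℝ} {B : ℝ} (hB : ∀ x, |f x| ≤ B) {w : ℝ} (hw : 0 < w) :
    Continuous (durrmeyer φ ψ w f) := by
  rw [funext fun x => durrmeyer_eq_sampleOp φ ψ hw f x]
  exact (continuous_sampleOp hθ hφ hφθ hψ fun _ => hB _).comp (continuous_const_mul w)

/-! ### The equivalence theorem -/

/-- The equivalence under the hypotheses that the cases `p = 1`, `1 < p < ∞` and `p = ∞` have in
common. The discrete absolute moment of `φ ^ (r)` is not needed for `p = 1`, and that of `ψ` is not
needed for `p = ∞`. -/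
theorem memLipStar_iff_hasRate (hr : 1 < r) (hφ : MemSobolev r 1 φ) (hψ : MemLp ψ 1 volume)
    (hφ0 : IsDiscreteKernel φ) (hψ0 : IsContinuousKernel ψ) (hii : VanishingMoments r φ ψ)
    {α : ℝ} (hα0 : 0 < α) (hαr : α < r) (hp : 1 ≤ p)
    (hφθ : ∀ i ≤ r, ∃ θ : ℝ, (r : ℝ) + 1 < θ ∧ DecaysLike θ (iteratedDeriv i φ))
    (hψθ : ∃ θ : ℝ, (r : ℝ) + 1 < θ ∧ DecaysLike θ ψ)
    (hφM : p ≠ 1 → absMoment 0 (iteratedDeriv r φ) < ⊤) (hψM : p ≠ ⊤ → absMoment 0 ψ < ⊤)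
    {f : ℝ → ℝ} (hf : MemSpace p f) : MemLipStar α p f ↔ HasRate φ ψ α p f := by
  have hr0 : (0 : ℝ) ≤ r := r.cast_nonneg
  have hφc : Continuous φ := hφ.2.1.continuous
  obtain ⟨θ, hθ, hdφ⟩ := hφθ 0 (by omega)
  rw [iteratedDeriv_zero] at hdφ
  obtain ⟨θ₁, hθ₁, hdφr⟩ := hφθ r le_rfl
  obtain ⟨θ₂, hθ₂, hdψ⟩ := hψθ
  obtain ⟨Bφ, hBφ⟩ := hdφ.bounded_of_continuous (by linarith) hφc
  obtain ⟨N, hNt, hN⟩ := exists_leftBound (p := p) hdφ hφ.1 hθ fun _ => ⟨Bφ, hBφ⟩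
  obtain ⟨N', hNt', hN'⟩ := exists_leftBound (p := p) hdφr hφ.2.2.2 hθ₁ fun h =>
    bounded_of_absMoment_lt_top (hφM h)
  obtain ⟨T, hT, hTx⟩ := hdφ.exists_tsum_mul_weight_le hθ hBφ
  -- `ψ` is replaced by a measurable representative.
  set ψ' := hψ.1.mk ψ with hψ'
  have hae : ψ =ᵐ[volume] ψ' := hψ.1.ae_eq_mk
  have hψm : Measurable ψ' := hψ.1.stronglyMeasurable_mk.measurable
  obtain ⟨A, hAt, hA⟩ := exists_rightBound (p := p) hdψ hψ hθ₂ hψM hae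
  have hmom : ∀ ν, continuousMoment ν ψ' = continuousMoment ν ψ := fun ν =>
    integral_congr_ae (by filter_upwards [hae] with u hu; rw [hu])
  have hrep : Reproduces r φ ψ' 1 := by
    refine reproduces_of_moments hr.le hψm (fun x => ne_top_of_le_ne_top hT (hTx x))
      (ne_top_of_le_ne_top hAt hA.lintegral_le) hφ0 ((hmom 0).trans hψ0) ?_
    intro i hi1 hir u
    simp only [hmom]
    exact hii i hi1 hir u
  have hΦm : Measurable (iteratedDeriv r φ) := by
    obtain ⟨n, rfl⟩ : ∃ n, r = n + 1 := ⟨r - 1, by omega⟩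
    rw [iteratedDeriv_succ]
    exact measurable_deriv _
  have key : ∀ {g : ℝ → ℝ}, Measurable g → MemLp g p volume → _ := fun hg hgp =>
    lpModulus_isBigO_iff_rate hr.le hp hφc.measurable hψm hN hNt hΦm hφ.iterPrim hN' hNt' hA hAt
      hrep hα0 hαr hg hgp
  by_cases hpt : p = ⊤
  · subst hpt
    have hfu := hf
    rw [MemSpace, if_pos rfl] at hfu
    obtain ⟨huc, B, hB⟩ := hfu
    have hfc := huc.continuous
    have hmod : ∀ δ, modulus ⊤ (⌊α⌋₊ + 1) f δ = lpModulus ⊤ (⌊α⌋₊ + 1) f δ := by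
      intro δ
      unfold modulus lpModulus
      refine iSup_congr fun t => iSup_congr fun _ => ?_
      rw [pNorm, if_pos rfl, iSup_enorm_eq_eLpNorm_top]
      unfold finDiff
      fun_prop
    have hfp : MemLp f ⊤ volume := memLp_top_of_bound hfc.aestronglyMeasurable B
      (ae_of_all _ fun x => hB x)
    have h := key hfc.measurable hfp
    rw [MemLipStar, and_iff_right hf, HasRate]
    simp only [hmod]
    rw [h]
    refine exists_congr fun C => ?_
    refine eventually_congr ?_
    filter_upwards [eventually_gt_atTop 0] with w hw
    rw [← durrmeyer_congr_ae φ hae (ae_eq_refl f) hw, pNorm, if_pos rfl, iSup_enorm_eq_eLpNorm_top]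
    exact (continuous_durrmeyer (by linarith) hφc hdφ hψ hB hw).sub hfc
  · have hfm := hf
    rw [MemSpace, if_neg hpt] at hfm
    set f' := hfm.1.mk f with hf'
    have hff : f =ᵐ[volume] f' := hfm.1.ae_eq_mk
    have hmod : ∀ δ, modulus p (⌊α⌋₊ + 1) f δ = lpModulus p (⌊α⌋₊ + 1) f' δ := by
      intro δ
      unfold modulus lpModulus
      refine iSup_congr fun t => iSup_congr fun _ => ?_
      rw [pNorm, if_neg hpt]
      exact eLpNorm_congr_ae (finDiff_ae_congr _ t hff)
    have h := key hfm.1.stronglyMeasurable_mk.measurable ((memLp_congr_ae hff).1 hfm)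
    rw [MemLipStar, and_iff_right hf, HasRate]
    simp only [hmod]
    rw [h]
    refine exists_congr fun C => ?_
    refine eventually_congr ?_
    filter_upwards [eventually_gt_atTop 0] with w hw
    rw [durrmeyer_congr_ae φ hae hff hw, pNorm, if_neg hpt]
    have : eLpNorm (fun x => durrmeyer φ ψ' w f' x - f' x) p volume
        = eLpNorm (fun x => durrmeyer φ ψ' w f' x - f x) p volume :=
      eLpNorm_congr_ae (by filter_upwards [hff] with x hx; rw [hx])
    rw [this]

end

end Durrmeyer

theorem mainTheorem1 (r : ℕ) (hr : 1 < r) (φ ψ : ℝ → ℝ)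
    (hφ : Durrmeyer.MemSobolev r 1 φ) (hψ : MemLp ψ 1 volume)
    (hφ0 : Durrmeyer.IsDiscreteKernel φ) (hψ0 : Durrmeyer.IsContinuousKernel ψ)
    (hi : Durrmeyer.ConstantMoments r φ) (hii : Durrmeyer.VanishingMoments r φ ψ)
    (α : ℝ) (hα0 : 0 < α) (hαr : α < r) :
    -- (I) the case `p = 1`
    ((∀ i ≤ r, ∃ θ : ℝ, (r : ℝ) + 1 < θ ∧ Durrmeyer.DecaysLike θ (iteratedDeriv i φ)) →
      HasCompactSupport ψ →
      Durrmeyer.absMoment 0 ψ < ⊤ →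
      ∀ f : ℝ → ℝ, Durrmeyer.MemSpace 1 f →
        (Durrmeyer.MemLipStar α 1 f ↔ Durrmeyer.HasRate φ ψ α 1 f)) ∧
    -- (II) the case `1 < p < ∞`
    (∀ p : ℝ, 1 < p →
      (∀ i ≤ r, ∃ θ : ℝ, p * r + 1 < θ ∧ Durrmeyer.DecaysLike θ (iteratedDeriv i φ)) →
      (∃ θ : ℝ, p * r + 1 < θ ∧ Durrmeyer.DecaysLike θ ψ) →
      Durrmeyer.absMoment 0 (iteratedDeriv r φ) < ⊤ →
      Durrmeyer.absMoment 0 ψ < ⊤ →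
      ∀ f : ℝ → ℝ, Durrmeyer.MemSpace (ENNReal.ofReal p) f →
        (Durrmeyer.MemLipStar α (ENNReal.ofReal p) f ↔
          Durrmeyer.HasRate φ ψ α (ENNReal.ofReal p) f)) ∧
    -- (III) the case `p = ∞`
    ((∀ i ≤ r, ∃ θ : ℝ, (r : ℝ) + 1 < θ ∧ Durrmeyer.DecaysLike θ (iteratedDeriv i φ)) →
      (∃ θ : ℝ, (r : ℝ) + 1 < θ ∧ Durrmeyer.DecaysLike θ ψ) →
      Durrmeyer.absMoment 0 (iteratedDeriv r φ) < ⊤ →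
      ∀ f : ℝ → ℝ, Durrmeyer.MemSpace ⊤ f →
        (Durrmeyer.MemLipStar α ⊤ f ↔ Durrmeyer.HasRate φ ψ α ⊤ f)) := by
  refine ⟨fun hφθ hψc hψM f hf => ?_, fun p hp hφθ hψθ hφM hψM f hf => ?_,
    fun hφθ hψθ hφM f hf => ?_⟩
  · exact Durrmeyer.memLipStar_iff_hasRate hr hφ hψ hφ0 hψ0 hii hα0 hαr le_rfl hφθ
      ⟨r + 2, by linarith, Durrmeyer.decaysLike_of_hasCompactSupport hψc _⟩
      (fun h => absurd rfl h) (fun _ => hψM) hf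
  · have hr0 : (0 : ℝ) ≤ r := r.cast_nonneg
    have hrp : (r : ℝ) + 1 ≤ p * r + 1 := by nlinarith
    refine Durrmeyer.memLipStar_iff_hasRate hr hφ hψ hφ0 hψ0 hii hα0 hαr
      (ENNReal.one_le_ofReal.2 hp.le) (fun i hi => ?_) ?_ (fun _ => hφM) (fun _ => hψM) hf
    · obtain ⟨θ, hθ, h⟩ := hφθ i hi
      exact ⟨θ, hrp.trans_lt hθ, h⟩
    · obtain ⟨θ, hθ, h⟩ := hψθ
      exact ⟨θ, hrp.trans_lt hθ, h⟩
  · exact Durrmeyer.memLipStar_iff_hasRate hr hφ hψ hφ0 hψ0 hii hα0 hαr le_top hφθ hψθ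
      (fun _ => hφM) (fun h => absurd rfl h) hf
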